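/- Let $f:\mathbb{R}^2\to\mathbb{R}^2$ be a $C^\infty$ map, let $\lambda,\sigma\in\mathbb{R}$ satisfy $0<|\lambda|<1<|\sigma|$ and $\lambda\sigma=1$, and let $A,B:\mathbb{R}\to\mathbb{R}$ be $C^\infty$ functions. Suppose that on a bounded, convex, open neighbourhood $\mathcal{N}$ of the origin $f$ equals the (orientation-preserving, resonant) normal form $$T_0(x,y)=\Big(\lambda x\,\big(1+xy\,A(xy)\big),\ \tfrac1\lambda\, y\,\big(1+xy\,B(xy)\big)\Big),$$ and put $a_1=A(0)$, $b_1=B(0)$. Let $x^*,y^*>0$ be such that $(x^*,0)$, $(\lambda x^*,0)$, $(0,y^*/\sigma)$, $(0,y^*/\sigma^2)$ all belong to $\mathcal{N}$, and suppose that $f^m(0,y^*)=(x^*,0)$ for some $m\ge 1$ (so that $(0,y^*)$ and $(x^*,0)$ lie on a homoclinic orbit of the origin). Let $T_1=f^m$ have at $(0,y^*)$ the Taylor expansion $$T_1(x,y)=\begin{bmatrix} x^*+c_1x+c_2(y-y^*)+\mathcal{O}\big((x,y-y^*)^2\big)\\ d_1x+d_2(y-y^*)+d_3x^2+d_4x(y-y^*)+d_5(y-y^*)^2+\mathcal{O}\big((x,y-y^*)^3\big)\end{bmatrix}.$$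 For $\eta>0$ let $\mathcal{N}_\eta=\{(x,y)\in\mathcal{N} : |xy|<\eta\}$. An $\mathrm{SR}_k$-solution (for this $\eta$) is a periodic solution of $f$ of least period $k+m$ that has $k$ consecutive points in $\mathcal{N}_\eta$. It is called asymptotically stable if it is Lyapunov stable and attracts all solutions starting sufficiently near it, and a saddle if one eigenvalue of $\mathrm{D}f^{k+m}$ at a point of the solution has modulus less than $1$ and the other has modulus greater than $1$. Suppose that $d_1=\frac{y^*}{x^*}$, $d_2=0$, $a_1+b_1=0$, $d_5\neq 0$, that $\Delta>0$, where $$\Delta=\Big(1-\frac{c_2y^*}{x^*}-\frac{d_4y^*}{d_1}\Big)^2-4d_5\big(d_3x^{*2}+c_1d_1x^*\big),$$ and that $$-1<\frac{c_2y^*}{x^*}<1-\frac{\sqrt{\Delta}}{2}.$$ Then for every $\eta>0$ there exists $k_{\min}$ such that for all $k\ge k_{\min}$ the map $f$ has an asymptotically stable $\mathrm{SR}_k$-solution and a saddle $\mathrm{SR}_k$-solution. These can be chosen, as two families indexed by $k$ and independent of $\eta$, such that the first of the $k$ consecutive points in $\mathcal{N}_\eta$ converges to $(x^*,0)$ as $k\to\infty$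 in both families. -/

import Mathlib

open Filter
open scoped Topology ContDiff

namespace GRHT

/-- The orientation-preserving resonant normal form
`T₀(x, y) = (l x (1 + x y A(x y)), l⁻¹ y (1 + x y B(x y)))`. -/
noncomputable def resonantNormalForm (l : ℝ) (A B : ℝ → ℝ) (p : ℝ × ℝ) : ℝ × ℝ :=
  (l * p.1 * (1 + p.1 * p.2 * A (p.1 * p.2)),
    1 / l * p.2 * (1 + p.1 * p.2 * B (p.1 * p.2)))

/-- Partial derivative with respect to the first coordinate. -/
noncomputable def partialX (g : ℝ × ℝ → ℝ) (p : ℝ × ℝ) : ℝ := fderiv ℝ g p (1, 0)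

/-- Partial derivative with respect to the second coordinate. -/
noncomputable def partialY (g : ℝ × ℝ → ℝ) (p : ℝ × ℝ) : ℝ := fderiv ℝ g p (0, 1)

/-- The numbers `c₁, c₂, d₁, …, d₅` are the Taylor coefficients of `T` at `P = (0, y*)`:
`T(x, y) = T(P) + (c₁ x + c₂ (y - y*) + O(2),
  d₁ x + d₂ (y - y*) + d₃ x² + d₄ x (y - y*) + d₅ (y - y*)² + O(3))`.
It is used only for smooth maps `T`. -/
structure HasTaylorCoeffs (T : ℝ × ℝ → ℝ × ℝ) (P : ℝ × ℝ)
    (c₁ c₂ d₁ d₂ d₃ d₄ d₅ : ℝ) : Prop where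
  c₁_eq : c₁ = partialX (fun q => (T q).1) P
  c₂_eq : c₂ = partialY (fun q => (T q).1) P
  d₁_eq : d₁ = partialX (fun q => (T q).2) P
  d₂_eq : d₂ = partialY (fun q => (T q).2) P
  d₃_eq : d₃ = partialX (partialX fun q => (T q).2) P / 2
  d₄_eq : d₄ = partialX (partialY fun q => (T q).2) P
  d₅_eq : d₅ = partialY (partialY fun q => (T q).2) P / 2

/-- The discriminant `Δ`. -/
noncomputable def discr (xs ys c₁ c₂ d₁ d₃ d₄ d₅ : ℝ) : ℝ :=
  (1 - c₂ * ys / xs - d₄ * ys / d₁) ^ 2 - 4 * d₅ * (d₃ * xs ^ 2 + c₁ * d₁ * xs)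

/-- The set `N_η` of the points of `N` with `|x y| < η`. -/
def nbhdEta (N : Set (ℝ × ℝ)) (η : ℝ) : Set (ℝ × ℝ) := {p | p ∈ N ∧ |p.1 * p.2| < η}

/-- The orbit of `p` is an `SR_k`-solution of `f`: it is periodic with (least) period `k + m`
and has `k` consecutive points in `N_η`, the first of which is `p`. -/
def IsSRSolution (f : ℝ × ℝ → ℝ × ℝ) (N : Set (ℝ × ℝ)) (η : ℝ) (m k : ℕ) (p : ℝ × ℝ) : Prop :=
  Function.minimalPeriod f p = k + m ∧ ∀ j < k, f^[j] p ∈ nbhdEta N η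

/-- The solution `i ↦ f^i(p)` is Lyapunov stable and locally attracting. -/
def IsAsymptoticallyStable (f : ℝ × ℝ → ℝ × ℝ) (p : ℝ × ℝ) : Prop :=
  (∀ ε > 0, ∃ δ > 0, ∀ q, dist q p < δ → ∀ i : ℕ, dist (f^[i] q) (f^[i] p) < ε) ∧
    ∃ δ > 0, ∀ q, dist q p < δ →
      Tendsto (fun i : ℕ => dist (f^[i] q) (f^[i] p)) atTop (𝓝 0)

/-- A solution through `p` of period `n` is a saddle: one eigenvalue of `D(f^n)(p)` lies inside
and the other one outside the unit circle. (In the plane both are then real.) -/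
def IsSaddle (f : ℝ × ℝ → ℝ × ℝ) (n : ℕ) (p : ℝ × ℝ) : Prop :=
  ∃ μ ν : ℝ, |μ| < 1 ∧ 1 < |ν| ∧
    Module.End.HasEigenvalue (fderiv ℝ (f^[n]) p : ℝ × ℝ →ₗ[ℝ] ℝ × ℝ) μ ∧
    Module.End.HasEigenvalue (fderiv ℝ (f^[n]) p : ℝ × ℝ →ₗ[ℝ] ℝ × ℝ) ν

end GRHT

namespace GRHT

/-! ### Planar linear maps: trace, determinant and stability -/

/-- The trace of a planar linear map. -/
noncomputable def planarTrace (L : ℝ × ℝ →L[ℝ] ℝ × ℝ) : ℝ := (L (1, 0)).1 + (L (0, 1)).2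

/-- The determinant of a planar linear map. -/
noncomputable def planarDet (L : ℝ × ℝ →L[ℝ] ℝ × ℝ) : ℝ :=
  (L (1, 0)).1 * (L (0, 1)).2 - (L (0, 1)).1 * (L (1, 0)).2

theorem planar_apply {E : Type*} [AddCommGroup E] [Module ℝ E] [TopologicalSpace E]
    (L : ℝ × ℝ →L[ℝ] E) (z : ℝ × ℝ) : L z = z.1 • L (1, 0) + z.2 • L (0, 1) := by
  have : z = z.1 • ((1 : ℝ), (0 : ℝ)) + z.2 • ((0 : ℝ), (1 : ℝ)) := by ext <;> simp
  conv_lhs => rw [this]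
  rw [map_add, map_smul, map_smul]

theorem hasEigenvalue_of_quadratic (L : ℝ × ℝ →L[ℝ] ℝ × ℝ) (μ : ℝ)
    (h : μ ^ 2 - planarTrace L * μ + planarDet L = 0) :
    Module.End.HasEigenvalue (L : ℝ × ℝ →ₗ[ℝ] ℝ × ℝ) μ := by
  unfold planarTrace planarDet at h
  have key : ∀ z : ℝ × ℝ, z ≠ 0 → L z = μ • z →
      Module.End.HasEigenvalue (L : ℝ × ℝ →ₗ[ℝ] ℝ × ℝ) μ := fun z hz hL =>
    Module.End.hasEigenvalue_of_hasEigenvector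
      (x := z) ⟨Module.End.mem_eigenspace_iff.2 (by simpa using hL), hz⟩
  have hap : ∀ z : ℝ × ℝ, L z = (z.1 * (L (1, 0)).1 + z.2 * (L (0, 1)).1,
      z.1 * (L (1, 0)).2 + z.2 * (L (0, 1)).2) := fun z => by
    rw [planar_apply L z]; rfl
  generalize (L (1, 0)).1 = a at *
  generalize (L (0, 1)).1 = b at *
  generalize (L (1, 0)).2 = c at *
  generalize (L (0, 1)).2 = d at *
  by_cases h1 : ((b, μ - a) : ℝ × ℝ) = 0
  · by_cases h2 : ((μ - d, c) : ℝ × ℝ) = 0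
    · simp only [Prod.mk_eq_zero] at h1 h2
      refine key (1, 0) (by simp) ?_
      rw [hap]
      ext <;> simp <;> linarith
    · refine key _ h2 ?_
      rw [hap]
      ext <;> simp <;> linarith
  · refine key _ h1 ?_
    rw [hap]
    ext <;> simp <;> linarith

theorem isSaddle_of_trace_det {f : ℝ × ℝ → ℝ × ℝ} {n : ℕ} {p : ℝ × ℝ}
    (h1 : 1 + planarDet (fderiv ℝ f^[n] p) < planarTrace (fderiv ℝ f^[n] p))
    (h2 : -(1 + planarDet (fderiv ℝ f^[n] p)) < planarTrace (fderiv ℝ f^[n] p)) :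
    IsSaddle f n p := by
  have hE := hasEigenvalue_of_quadratic (fderiv ℝ f^[n] p)
  set τ := planarTrace (fderiv ℝ f^[n] p)
  set δ := planarDet (fderiv ℝ f^[n] p)
  have hD : 0 < τ ^ 2 - 4 * δ := by nlinarith [sq_nonneg (τ - 2)]
  set r := √(τ ^ 2 - 4 * δ) with hr
  have hr0 : 0 < r := Real.sqrt_pos.2 hD
  have hrr : r ^ 2 = τ ^ 2 - 4 * δ := Real.sq_sqrt hD.le
  have hr1 : |τ - 2| < r := abs_lt_of_sq_lt_sq (by nlinarith) hr0.le
  obtain ⟨ha, hb⟩ := abs_lt.1 hr1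
  have hc : r < τ + 2 := by
    refine lt_of_pow_lt_pow_left₀ 2 (by linarith) (by nlinarith)
  refine ⟨(τ - r) / 2, (τ + r) / 2, abs_lt.2 ⟨by linarith, by linarith⟩,
    lt_of_lt_of_le (by linarith) (le_abs_self _), hE _ (by nlinarith), hE _ (by nlinarith)⟩

theorem tendsto_zero_of_linear_recurrence {τ δ : ℝ} (h1 : |τ| < 1 + δ) (h2 : δ < 1)
    {s : ℕ → ℝ} (hs : ∀ n, s (n + 2) = τ * s (n + 1) - δ * s n) : Tendsto s atTop (𝓝 0) := by
  have hδ : 0 < 1 + δ := (abs_nonneg τ).trans_lt h1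
  have hτ : τ ^ 2 < (1 + δ) ^ 2 := sq_lt_sq' (by linarith [neg_abs_le τ]) (by linarith [le_abs_self τ])
  set κ := (1 - δ) * ((1 + δ) ^ 2 - τ ^ 2) / 2 with hκ
  have hκ0 : 0 < κ := by
    have := mul_pos (sub_pos.2 h2) (sub_pos.2 hτ)
    linarith
  set α := (1 + δ) * δ ^ 2 + κ with hα
  set V : ℕ → ℝ := fun n =>
    α * s n ^ 2 - 2 * (τ * δ) * s n * s (n + 1) + (1 + δ) * s (n + 1) ^ 2 with hV
  have hVpos : ∀ n, 0 ≤ V n := by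
    intro n
    have e : (1 + δ) * V n = ((1 + δ) * s (n + 1) - τ * δ * s n) ^ 2 +
      (δ ^ 2 * ((1 + δ) ^ 2 - τ ^ 2) + (1 + δ) * κ) * s n ^ 2 := by
      simp only [hV, hα]; ring
    have : 0 ≤ (1 + δ) * V n := by
      rw [e]
      have := sub_pos.2 hτ
      positivity
    exact nonneg_of_mul_nonneg_right this hδ
  have hstep : ∀ n, κ * s n ^ 2 ≤ V n - V (n + 1) := by
    intro n
    have : V n - V (n + 1) = κ * s n ^ 2 + κ * s (n + 1) ^ 2 := by
      simp only [hV, hα, hκ, hs n]; ring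
    rw [this]
    have := sq_nonneg (s (n + 1))
    nlinarith
  have hsum : Summable fun n => κ * s n ^ 2 := by
    refine summable_of_sum_range_le (c := V 0) (fun n => by positivity) fun n => ?_
    calc ∑ i ∈ Finset.range n, κ * s i ^ 2 ≤ ∑ i ∈ Finset.range n, (V i - V (i + 1)) :=
          Finset.sum_le_sum fun i _ => hstep i
      _ = V 0 - V n := Finset.sum_range_sub' V n
      _ ≤ V 0 := by linarith [hVpos n]
  have h0 := hsum.tendsto_atTop_zero
  have h3 : Tendsto (fun n => s n ^ 2) atTop (𝓝 0) := by
    have := h0.const_mul κ⁻¹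
    simpa [← mul_assoc, hκ0.ne'] using this
  have h4 := h3.sqrt
  simp only [Real.sqrt_sq_eq_abs, Real.sqrt_zero] at h4
  exact (tendsto_zero_iff_abs_tendsto_zero _).2 h4

theorem planar_cayley_hamilton (L : ℝ × ℝ →L[ℝ] ℝ × ℝ) (z : ℝ × ℝ) :
    L (L z) = planarTrace L • L z - planarDet L • z := by
  have hap : ∀ z : ℝ × ℝ, L z = (z.1 * (L (1, 0)).1 + z.2 * (L (0, 1)).1,
      z.1 * (L (1, 0)).2 + z.2 * (L (0, 1)).2) := fun z => by
    rw [planar_apply L z]; rfl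
  unfold planarTrace planarDet
  rw [hap (L z), hap z]
  ext <;> simp <;> ring

theorem tendsto_iterate_planar {L : ℝ × ℝ →L[ℝ] ℝ × ℝ}
    (h1 : |planarTrace L| < 1 + planarDet L) (h2 : planarDet L < 1) (z : ℝ × ℝ) :
    Tendsto (fun n : ℕ => (L ^ n) z) atTop (𝓝 0) := by
  have hs : ∀ n, (L ^ (n + 2)) z =
      planarTrace L • (L ^ (n + 1)) z - planarDet L • (L ^ n) z := fun n => by
    rw [pow_succ', pow_succ']
    exact planar_cayley_hamilton L _
  rw [show (0 : ℝ × ℝ) = ((0 : ℝ), (0 : ℝ)) from rfl]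
  exact (tendsto_zero_of_linear_recurrence h1 h2 fun n => congrArg Prod.fst (hs n)).prodMk_nhds
    (tendsto_zero_of_linear_recurrence h1 h2 fun n => congrArg Prod.snd (hs n))

theorem exists_pow_norm_le {L : ℝ × ℝ →L[ℝ] ℝ × ℝ}
    (h1 : |planarTrace L| < 1 + planarDet L) (h2 : planarDet L < 1) {c : ℝ} (hc : 0 < c) :
    ∃ n : ℕ, 0 < n ∧ ∀ z, ‖(L ^ n) z‖ ≤ c * ‖z‖ := by
  have ht : Tendsto (fun n : ℕ => ‖(L ^ n) (1, 0)‖ + ‖(L ^ n) (0, 1)‖) atTop (𝓝 0) := by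
    simpa using (tendsto_iterate_planar h1 h2 (1, 0)).norm.add
      (tendsto_iterate_planar h1 h2 (0, 1)).norm
  obtain ⟨n, hn, hn0⟩ := ((ht.eventually (ge_mem_nhds hc)).and (eventually_gt_atTop 0)).exists
  refine ⟨n, hn0, fun z => ?_⟩
  rw [planar_apply (L ^ n) z]
  calc ‖z.1 • (L ^ n) (1, 0) + z.2 • (L ^ n) (0, 1)‖
      ≤ ‖z.1‖ * ‖(L ^ n) (1, 0)‖ + ‖z.2‖ * ‖(L ^ n) (0, 1)‖ := by
        simpa only [norm_smul] using norm_add_le (z.1 • (L ^ n) (1, 0)) (z.2 • (L ^ n) (0, 1))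
    _ ≤ ‖z‖ * ‖(L ^ n) (1, 0)‖ + ‖z‖ * ‖(L ^ n) (0, 1)‖ := by
        gcongr
        exacts [norm_fst_le z, norm_snd_le z]
    _ = (‖(L ^ n) (1, 0)‖ + ‖(L ^ n) (0, 1)‖) * ‖z‖ := by ring
    _ ≤ c * ‖z‖ := by gcongr

/-- A periodic solution is asymptotically stable if an iterate of the return map contracts
distances to one of its points. -/
theorem isAsymptoticallyStable_of_contracting {f : ℝ × ℝ → ℝ × ℝ} (hf : Continuous f)
    {n : ℕ} (hn : 0 < n) {p : ℝ × ℝ} (hp : f^[n] p = p) {r : ℝ} (hr : 0 < r)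
    (hc : ∀ q, dist q p < r → dist (f^[n] q) p ≤ 1 / 2 * dist q p) :
    IsAsymptoticallyStable f p := by
  have hpow : ∀ a : ℕ, ∀ q, dist q p < r →
      dist (f^[n * a] q) p ≤ (1 / 2) ^ a * dist q p := by
    intro a q hq
    induction a with
    | zero => simp
    | succ a ih =>
      have hlt : dist (f^[n * a] q) p < r := by
        refine (ih.trans ?_).trans_lt hq
        exact mul_le_of_le_one_left dist_nonneg (pow_le_one₀ (by norm_num) (by norm_num))
      rw [mul_add, mul_one, add_comm, Function.iterate_add_apply]
      refine (hc _ hlt).trans ?_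
      rw [pow_succ']
      linarith
  have hper : ∀ a : ℕ, f^[n * a] p = p := fun a => by
    rw [Function.iterate_mul]; exact Function.iterate_fixed hp a
  have hsplit : ∀ (q : ℝ × ℝ) (i : ℕ), f^[i] q = f^[i % n] (f^[n * (i / n)] q) := fun q i => by
    rw [← Function.iterate_add_apply, Nat.mod_add_div]
  have hunif : ∀ ε > 0, ∃ δ > 0, ∀ q, dist q p < δ → ∀ i < n,
      dist (f^[i] q) (f^[i] p) < ε := by
    intro ε hε
    have : ∀ᶠ q in 𝓝 p, ∀ i ∈ Finset.range n, dist (f^[i] q) (f^[i] p) < ε := by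
      rw [Filter.eventually_all_finset]
      intro i _
      exact (hf.iterate i).continuousAt.eventually (Metric.ball_mem_nhds _ hε)
    obtain ⟨δ, hδ, h⟩ := Metric.eventually_nhds_iff.1 this
    exact ⟨δ, hδ, fun q hq i hi => h hq i (Finset.mem_range.2 hi)⟩
  refine ⟨fun ε hε => ?_, r, hr, fun q hq => ?_⟩
  · obtain ⟨δ, hδ, h⟩ := hunif ε hε
    refine ⟨min δ r, lt_min hδ hr, fun q hq i => ?_⟩
    rw [hsplit q i, hsplit p i, hper]
    refine h _ ?_ _ (Nat.mod_lt _ hn)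
    refine (hpow _ q (hq.trans_le (min_le_right _ _))).trans_lt ?_
    refine (mul_le_of_le_one_left dist_nonneg (pow_le_one₀ (by norm_num) (by norm_num))).trans_lt
      (hq.trans_le (min_le_left _ _))
  · rw [Metric.tendsto_atTop]
    intro ε hε
    obtain ⟨δ, hδ, h⟩ := hunif ε hε
    have ht : Tendsto (fun a : ℕ => (1 / 2 : ℝ) ^ a * dist q p) atTop (𝓝 0) := by
      simpa using (tendsto_pow_atTop_nhds_zero_of_lt_one (r := (1 / 2 : ℝ))
        (by norm_num) (by norm_num)).mul_const (dist q p)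
    obtain ⟨a, ha⟩ := eventually_atTop.1 (ht.eventually (gt_mem_nhds hδ))
    refine ⟨n * a, fun i hi => ?_⟩
    rw [Real.dist_eq, sub_zero, abs_of_nonneg dist_nonneg, hsplit q i, hsplit p i, hper]
    refine h _ ((hpow _ q hq).trans_lt (ha _ ?_)) _ (Nat.mod_lt _ hn)
    exact (Nat.le_div_iff_mul_le hn).2 (by rwa [mul_comm])

theorem contDiff_iterate {E : Type*} [NormedAddCommGroup E] [NormedSpace ℝ E] {f : E → E}
    {n : WithTop ℕ∞} (hf : ContDiff ℝ n f) : ∀ k : ℕ, ContDiff ℝ n f^[k]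
  | 0 => contDiff_id
  | k + 1 => (contDiff_iterate hf k).comp hf

theorem isAsymptoticallyStable_of_trace_det {f : ℝ × ℝ → ℝ × ℝ} (hf : ContDiff ℝ ∞ f)
    {n : ℕ} (hn : 0 < n) {p : ℝ × ℝ} (hp : f^[n] p = p)
    (h1 : |planarTrace (fderiv ℝ f^[n] p)| < 1 + planarDet (fderiv ℝ f^[n] p))
    (h2 : planarDet (fderiv ℝ f^[n] p) < 1) : IsAsymptoticallyStable f p := by
  obtain ⟨j, hj, hL⟩ := exists_pow_norm_le h1 h2 (c := 1 / 4) (by norm_num)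
  have hd : HasFDerivAt f^[n] (fderiv ℝ f^[n] p) p :=
    ((contDiff_iterate hf n).differentiable (by simp)).differentiableAt.hasFDerivAt
  have hdj := hd.iterate hp j
  rw [← Function.iterate_mul] at hdj
  have hpj : f^[n * j] p = p := by
    rw [Function.iterate_mul]; exact Function.iterate_fixed hp j
  have hlo := hdj.isLittleO.def (c := 1 / 4) (by norm_num)
  obtain ⟨r, hr, h⟩ := Metric.eventually_nhds_iff.1 hlo
  refine isAsymptoticallyStable_of_contracting hf.continuous (Nat.mul_pos hn hj) hpj hr
    fun q hq => ?_
  have h3 := h hq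
  rw [hpj] at h3
  rw [dist_eq_norm, dist_eq_norm]
  have h4 := hL (q - p)
  calc ‖f^[n * j] q - p‖ = ‖(f^[n * j] q - p - (fderiv ℝ f^[n] p ^ j) (q - p))
        + (fderiv ℝ f^[n] p ^ j) (q - p)‖ := by congr 1; abel
    _ ≤ _ := norm_add_le _ _
    _ ≤ 1 / 2 * ‖q - p‖ := by linarith

/-! ### The scalar cocycle of the resonant normal form -/

/-- The map induced by the resonant normal form on the product `u = x y`. -/
noncomputable def productMap (A B : ℝ → ℝ) (u : ℝ) : ℝ := u * ((1 + u * A u) * (1 + u * B u))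

/-- The product of `1 + u a(u)` along the first `j` points of the orbit of `u` under `φ`. -/
noncomputable def cocycle (φ a : ℝ → ℝ) (j : ℕ) (u : ℝ) : ℝ :=
  ∏ i ∈ Finset.range j, (1 + φ^[i] u * a (φ^[i] u))

theorem cocycle_zero (φ a : ℝ → ℝ) : cocycle φ a 0 = fun _ => 1 := by
  ext; simp [cocycle]

theorem cocycle_succ (φ a : ℝ → ℝ) (j : ℕ) :
    cocycle φ a (j + 1) = fun u => cocycle φ a j u * (1 + φ^[j] u * a (φ^[j] u)) := by
  ext; simp [cocycle, Finset.prod_range_succ]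

theorem iterate_productMap (A B : ℝ → ℝ) (j : ℕ) (u : ℝ) :
    (productMap A B)^[j] u =
      u * (cocycle (productMap A B) A j u * cocycle (productMap A B) B j u) := by
  induction j with
  | zero => simp [cocycle]
  | succ j ih =>
    rw [Function.iterate_succ_apply', cocycle_succ, cocycle_succ]
    beta_reduce
    conv_lhs => rw [productMap]
    generalize (1 + (productMap A B)^[j] u * A ((productMap A B)^[j] u)) = x at *
    generalize (1 + (productMap A B)^[j] u * B ((productMap A B)^[j] u)) = y at *
    rw [ih]; ring

theorem contDiff_productMap {A B : ℝ → ℝ} (hA : ContDiff ℝ ∞ A) (hB : ContDiff ℝ ∞ B) :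
    ContDiff ℝ ∞ (productMap A B) := by
  unfold productMap; fun_prop

theorem contDiff_cocycle {φ a : ℝ → ℝ} (hφ : ContDiff ℝ ∞ φ) (ha : ContDiff ℝ ∞ a) (j : ℕ) :
    ContDiff ℝ ∞ (cocycle φ a j) := by
  unfold cocycle
  have := contDiff_iterate hφ
  exact contDiff_prod fun i _ => contDiff_const.add ((this i).mul (ha.comp (this i)))

theorem exists_bound_unit {g : ℝ → ℝ} (hg : Continuous g) :
    ∃ K : ℝ, ∀ u, |u| ≤ 1 → |g u| ≤ K := by
  obtain ⟨K, hK⟩ := isCompact_Icc.exists_bound_of_continuousOn (s := Set.Icc (-1 : ℝ) 1)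
    hg.continuousOn
  exact ⟨K, fun u hu => hK u (abs_le.1 hu)⟩

theorem exists_lipschitz_zero {g : ℝ → ℝ} (hg : ContDiff ℝ ∞ g) :
    ∃ K : ℝ, ∀ u, |u| ≤ 1 → |g u - g 0| ≤ K * |u| := by
  obtain ⟨K, hK⟩ := exists_bound_unit (hg.continuous_deriv (by simp))
  refine ⟨K, fun u hu => ?_⟩
  have := (convex_Icc (-1 : ℝ) 1).norm_image_sub_le_of_norm_deriv_le (f := g) (C := K)
    (fun x _ => (hg.differentiable (by simp)).differentiableAt) (fun x hx => hK x (abs_le.2 hx))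
    (x := 0) (y := u) (Set.mem_Icc.2 (by norm_num)) (abs_le.1 hu)
  simpa using this

/-- Bounds on the unit interval for the ingredients of the scalar cocycle. -/
structure CocycleBound (A B : ℝ → ℝ) (K : ℝ) : Prop where
  one_le : 1 ≤ K
  fst_le : ∀ u, |u| ≤ 1 → |A u| ≤ K
  snd_le : ∀ u, |u| ≤ 1 → |B u| ≤ K
  fst_deriv_le : ∀ u, |u| ≤ 1 → |deriv (fun t => t * A t) u| ≤ K
  snd_deriv_le : ∀ u, |u| ≤ 1 → |deriv (fun t => t * B t) u| ≤ K
  prod_le : ∀ u, |u| ≤ 1 → |(1 + u * A u) * (1 + u * B u) - 1| ≤ K * u ^ 2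
  deriv_le : ∀ u, |u| ≤ 1 → |deriv (productMap A B) u| ≤ 1 + K * |u|

theorem exists_cocycleBound {A B : ℝ → ℝ} (hA : ContDiff ℝ ∞ A) (hB : ContDiff ℝ ∞ B)
    (hab : A 0 + B 0 = 0) : ∃ K, CocycleBound A B K := by
  have h1 : ContDiff ℝ ∞ fun t => t * A t := by fun_prop
  have h2 : ContDiff ℝ ∞ fun t => t * B t := by fun_prop
  have hφ := contDiff_productMap hA hB
  obtain ⟨K₁, hK₁⟩ := exists_bound_unit hA.continuous
  obtain ⟨K₂, hK₂⟩ := exists_bound_unit hB.continuous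
  obtain ⟨K₃, hK₃⟩ := exists_bound_unit (h1.continuous_deriv (by simp))
  obtain ⟨K₄, hK₄⟩ := exists_bound_unit (h2.continuous_deriv (by simp))
  obtain ⟨K₅, hK₅⟩ := exists_lipschitz_zero (hA.add hB)
  obtain ⟨K₆, hK₆⟩ := exists_lipschitz_zero (g := deriv (productMap A B))
    ((contDiff_infty_iff_deriv.1 hφ).2)
  have hφ0 : deriv (productMap A B) 0 = 1 := by
    have hd : HasDerivAt (productMap A B) (1 * ((1 + 0 * A 0) * (1 + 0 * B 0)) + 0 *
        deriv (fun u => (1 + u * A u) * (1 + u * B u)) 0) 0 := by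
      refine (hasDerivAt_id (0 : ℝ)).mul (DifferentiableAt.hasDerivAt ?_)
      have hA' := (hA.differentiable (by simp)).differentiableAt (x := (0 : ℝ))
      have hB' := (hB.differentiable (by simp)).differentiableAt (x := (0 : ℝ))
      fun_prop
    simpa using hd.deriv
  rw [hφ0] at hK₆
  set K := 1 + |K₁| + |K₂| + |K₃| + |K₄| + |K₅| + |K₆| + |K₁| * |K₂| with hK
  have p1 := abs_nonneg K₁
  have p2 := abs_nonneg K₂
  have p3 := abs_nonneg K₃
  have p4 := abs_nonneg K₄
  have p5 := abs_nonneg K₅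
  have p6 := abs_nonneg K₆
  have p7 := mul_nonneg p1 p2
  refine ⟨K, by linarith, fun u hu => ?_, fun u hu => ?_, fun u hu => ?_, fun u hu => ?_,
    fun u hu => ?_, fun u hu => ?_⟩
  · linarith [hK₁ u hu, le_abs_self K₁]
  · linarith [hK₂ u hu, le_abs_self K₂]
  · linarith [hK₃ u hu, le_abs_self K₃]
  · linarith [hK₄ u hu, le_abs_self K₄]
  · have e : (1 + u * A u) * (1 + u * B u) - 1 = u * (A u + B u) + u ^ 2 * (A u * B u) := by ring
    have h5 : |A u + B u| ≤ |K₅| * |u| := by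
      have := hK₅ u hu
      simp only [hab, sub_zero] at this
      exact this.trans (mul_le_mul_of_nonneg_right (le_abs_self _) (abs_nonneg _))
    have h6 : |A u * B u| ≤ |K₁| * |K₂| := by
      rw [abs_mul]
      exact mul_le_mul ((hK₁ u hu).trans (le_abs_self _)) ((hK₂ u hu).trans (le_abs_self _))
        (abs_nonneg _) p1
    rw [e]
    calc _ ≤ |u * (A u + B u)| + |u ^ 2 * (A u * B u)| := abs_add_le _ _
      _ = |u| * |A u + B u| + u ^ 2 * |A u * B u| := by
        rw [abs_mul, abs_mul, abs_of_nonneg (sq_nonneg u)]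
      _ ≤ |u| * (|K₅| * |u|) + u ^ 2 * (|K₁| * |K₂|) := by gcongr
      _ = (|K₅| + |K₁| * |K₂|) * u ^ 2 := by rw [← sq_abs u]; ring
      _ ≤ K * u ^ 2 := by gcongr; linarith
  · have h7 := hK₆ u hu
    have h8 : K₆ * |u| ≤ K * |u| := by gcongr; linarith [le_abs_self K₆]
    have h9 := abs_sub_abs_le_abs_sub (deriv (productMap A B) u) 1
    rw [abs_one] at h9
    linarith

section Estimates

variable {A B : ℝ → ℝ} {K ρ : ℝ} {k : ℕ}

theorem one_add_pow_le_two (hK : CocycleBound A B K) (hρ : 0 ≤ ρ) (hk : 8 * K * k * ρ ≤ 1)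
    {j : ℕ} (hj : j ≤ k) : (1 + 2 * K * ρ) ^ j ≤ 2 := by
  have hK0 := hK.one_le
  have hjk : (j : ℝ) ≤ k := by exact_mod_cast hj
  have h1 : (j : ℝ) * (2 * K * ρ) ≤ 1 / 4 := by
    have : (j : ℝ) * (2 * K * ρ) ≤ k * (2 * K * ρ) := by gcongr
    linarith
  calc (1 + 2 * K * ρ) ^ j ≤ Real.exp (2 * K * ρ) ^ j := by
        gcongr
        linarith [Real.add_one_le_exp (2 * K * ρ)]
    _ = Real.exp (j * (2 * K * ρ)) := by rw [Real.exp_nat_mul]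
    _ ≤ 2 := by
      have hx : 0 ≤ (j : ℝ) * (2 * K * ρ) := by positivity
      have := Real.abs_exp_sub_one_le (x := j * (2 * K * ρ)) (by rw [abs_of_nonneg hx]; linarith)
      rw [abs_of_nonneg hx] at this
      linarith [le_abs_self (Real.exp (j * (2 * K * ρ)) - 1)]

theorem abs_iterate_productMap_le (hK : CocycleBound A B K) (hρ : 0 ≤ ρ)
    (hk : 8 * K * k * ρ ≤ 1) (hρ1 : 8 * K * ρ ≤ 1) {u : ℝ} (hu : |u| ≤ ρ) {j : ℕ} (hj : j ≤ k) :
    |(productMap A B)^[j] u| ≤ 2 * ρ := by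
  have hK0 := hK.one_le
  have h2 : 2 * ρ ≤ 1 := by nlinarith
  have main : |(productMap A B)^[j] u| ≤ (1 + 2 * K * ρ) ^ j * ρ := by
    induction j with
    | zero => simpa using hu
    | succ j ih =>
      have ih := ih (by omega)
      have hle : |(productMap A B)^[j] u| ≤ 2 * ρ :=
        ih.trans (mul_le_mul_of_nonneg_right (one_add_pow_le_two hK hρ hk (by omega)) hρ)
      rw [Function.iterate_succ_apply']
      set t := (productMap A B)^[j] u
      have hp := hK.prod_le t (hle.trans h2)
      have ht : t ^ 2 ≤ 2 * ρ := by
        rw [← sq_abs]; nlinarith [abs_nonneg t]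
      have hq : |(1 + t * A t) * (1 + t * B t)| ≤ 1 + 2 * K * ρ := by
        have := abs_sub_abs_le_abs_sub ((1 + t * A t) * (1 + t * B t)) 1
        rw [abs_one] at this
        nlinarith
      rw [productMap, abs_mul, pow_succ]
      calc _ ≤ ((1 + 2 * K * ρ) ^ j * ρ) * (1 + 2 * K * ρ) := by gcongr
        _ = _ := by ring
  exact main.trans (mul_le_mul_of_nonneg_right (one_add_pow_le_two hK hρ hk hj) hρ)

theorem abs_prod_sub_one_le {g : ℕ → ℝ} {c : ℝ} (hc : 0 ≤ c) (hc1 : k * c ≤ 1)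
    {j : ℕ} (hj : j ≤ k) (hg : ∀ i < j, |g i - 1| ≤ c) :
    |∏ i ∈ Finset.range j, g i - 1| ≤ 2 * (k * c) := by
  have hjk : (j : ℝ) ≤ k := by exact_mod_cast hj
  have h0 : 0 ≤ (k : ℝ) * c := by positivity
  have h1 := Finset.norm_prod_one_add_sub_one_le (Finset.range j) (fun i => g i - 1)
  simp only [add_sub_cancel, Real.norm_eq_abs] at h1
  have h2 : ∑ i ∈ Finset.range j, |g i - 1| ≤ k * c := by
    calc _ ≤ ∑ i ∈ Finset.range j, c :=
          Finset.sum_le_sum fun i hi => hg i (Finset.mem_range.1 hi)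
      _ = j * c := by simp
      _ ≤ k * c := by gcongr
  have h3 := Real.abs_exp_sub_one_le (x := k * c) (by rwa [abs_of_nonneg h0])
  rw [abs_of_nonneg h0] at h3
  have h4 := Real.exp_le_exp.2 h2
  linarith [le_abs_self (Real.exp (k * c) - 1)]

theorem abs_cocycle_sub_one_le (hK : CocycleBound A B K) (hρ : 0 ≤ ρ)
    (hk : 8 * K * k * ρ ≤ 1) (hρ1 : 8 * K * ρ ≤ 1) {a : ℝ → ℝ}
    (ha : ∀ u, |u| ≤ 1 → |a u| ≤ K) {u : ℝ} (hu : |u| ≤ ρ) {j : ℕ} (hj : j ≤ k) :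
    |cocycle (productMap A B) a j u - 1| ≤ 4 * K * k * ρ := by
  have hK0 := hK.one_le
  have h2 : 2 * ρ ≤ 1 := by nlinarith
  have := abs_prod_sub_one_le (k := k) (c := 2 * K * ρ) (by positivity) (by linarith) hj
    (g := fun i => 1 + (productMap A B)^[i] u * a ((productMap A B)^[i] u)) fun i hi => by
      have hle := abs_iterate_productMap_le hK hρ hk hρ1 hu (j := i) (by omega)
      rw [add_sub_cancel_left, abs_mul]
      calc _ ≤ 2 * ρ * K := by
            gcongr
            exact ha _ (hle.trans h2)
        _ = _ := by ring
  rw [cocycle]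
  linarith

theorem abs_cocycle_mul_sub_one_le (hK : CocycleBound A B K) (hρ : 0 ≤ ρ)
    (hk : 8 * K * k * ρ ≤ 1) (hρ1 : 8 * K * ρ ≤ 1) {u : ℝ} (hu : |u| ≤ ρ) {j : ℕ} (hj : j ≤ k) :
    |cocycle (productMap A B) A j u * cocycle (productMap A B) B j u - 1| ≤
      8 * K * k * ρ ^ 2 := by
  have hK0 := hK.one_le
  have h2 : 8 * ρ ≤ 1 := by nlinarith
  have hk' : k * (4 * K * ρ ^ 2) ≤ 1 := by
    calc k * (4 * K * ρ ^ 2) = (8 * K * k * ρ) * (ρ / 2) := by ring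
      _ ≤ 1 * 1 := by gcongr; linarith
      _ = 1 := by norm_num
  have := abs_prod_sub_one_le (k := k) (c := 4 * K * ρ ^ 2) (by positivity) hk' hj
    (g := fun i => (1 + (productMap A B)^[i] u * A ((productMap A B)^[i] u)) *
      (1 + (productMap A B)^[i] u * B ((productMap A B)^[i] u))) fun i hi => by
      have hle := abs_iterate_productMap_le hK hρ hk hρ1 hu (j := i) (by omega)
      refine (hK.prod_le _ (hle.trans (by linarith))).trans ?_
      rw [← sq_abs]
      calc _ ≤ K * (2 * ρ) ^ 2 := by gcongr
        _ = _ := by ring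
  rw [cocycle, cocycle, ← Finset.prod_mul_distrib]
  linarith

theorem abs_deriv_iterate_productMap_le (hA : ContDiff ℝ ∞ A) (hB : ContDiff ℝ ∞ B)
    (hK : CocycleBound A B K) (hρ : 0 ≤ ρ)
    (hk : 8 * K * k * ρ ≤ 1) (hρ1 : 8 * K * ρ ≤ 1) {u : ℝ} (hu : |u| ≤ ρ) {j : ℕ} (hj : j ≤ k) :
    |deriv (productMap A B)^[j] u| ≤ 2 := by
  have hK0 := hK.one_le
  have hφ := contDiff_productMap hA hB
  have main : |deriv (productMap A B)^[j] u| ≤ (1 + 2 * K * ρ) ^ j := by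
    induction j with
    | zero => simp
    | succ j ih =>
      have ih := ih (by omega)
      have hle := abs_iterate_productMap_le hK hρ hk hρ1 hu (j := j) (by omega)
      rw [Function.iterate_succ', deriv_comp _ (hφ.differentiable (by simp)).differentiableAt
        ((contDiff_iterate hφ j).differentiable (by simp)).differentiableAt, abs_mul, pow_succ']
      refine mul_le_mul ?_ ih (abs_nonneg _) (by positivity)
      refine (hK.deriv_le _ (hle.trans (by nlinarith))).trans ?_
      nlinarith
  exact main.trans (one_add_pow_le_two hK hρ hk hj)

theorem abs_deriv_cocycle_le (hA : ContDiff ℝ ∞ A) (hB : ContDiff ℝ ∞ B)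
    (hK : CocycleBound A B K) (hρ : 0 ≤ ρ) (hk : 8 * K * k * ρ ≤ 1) (hρ1 : 8 * K * ρ ≤ 1)
    {a : ℝ → ℝ} (hac : ContDiff ℝ ∞ a) (ha : ∀ u, |u| ≤ 1 → |a u| ≤ K)
    (ha' : ∀ u, |u| ≤ 1 → |deriv (fun t => t * a t) u| ≤ K)
    {u : ℝ} (hu : |u| ≤ ρ) {j : ℕ} (hj : j ≤ k) :
    |deriv (cocycle (productMap A B) a j) u| ≤ 8 * K * k := by
  have hK0 := hK.one_le
  have hφ := contDiff_productMap hA hB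
  have h2 : 2 * ρ ≤ 1 := by nlinarith
  have main : |deriv (cocycle (productMap A B) a j) u| ≤ 4 * K * j * (1 + 2 * K * ρ) ^ j := by
    induction j with
    | zero => simp [cocycle_zero]
    | succ j ih =>
      have ih := ih (by omega)
      have hle := abs_iterate_productMap_le hK hρ hk hρ1 hu (j := j) (by omega)
      have hU := abs_deriv_iterate_productMap_le hA hB hK hρ hk hρ1 hu (j := j) (by omega)
      have hP := abs_cocycle_sub_one_le hK hρ hk hρ1 ha hu (j := j) (by omega)
      have hP2 : |cocycle (productMap A B) a j u| ≤ 2 := by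
        have := abs_sub_abs_le_abs_sub (cocycle (productMap A B) a j u) 1
        rw [abs_one] at this
        linarith
      set t := (productMap A B)^[j] u with ht
      have hta : |1 + t * a t| ≤ 1 + 2 * K * ρ := by
        refine (abs_add_le _ _).trans ?_
        rw [abs_one, abs_mul]
        have : |t| * |a t| ≤ 2 * ρ * K := by
          gcongr
          exact ha _ (hle.trans h2)
        linarith
      have d1 : HasDerivAt (productMap A B)^[j] (deriv (productMap A B)^[j] u) u :=
        ((contDiff_iterate hφ j).differentiable (by simp)).differentiableAt.hasDerivAt
      have d2 : HasDerivAt (fun t => t * a t) (deriv (fun t => t * a t) t) t :=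
        DifferentiableAt.hasDerivAt
          ((contDiff_id.mul hac).differentiable (by simp)).differentiableAt
      have d3 : HasDerivAt (cocycle (productMap A B) a j)
          (deriv (cocycle (productMap A B) a j) u) u :=
        ((contDiff_cocycle hφ hac j).differentiable (by simp)).differentiableAt.hasDerivAt
      have d4 : HasDerivAt (cocycle (productMap A B) a (j + 1))
          (deriv (cocycle (productMap A B) a j) u * (1 + t * a t) +
            cocycle (productMap A B) a j u *
              (deriv (fun t => t * a t) t * deriv (productMap A B)^[j] u)) u := by
        rw [cocycle_succ]
        exact d3.mul ((d2.comp u d1).const_add 1)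
      rw [d4.deriv]
      have h1 : (1 : ℝ) ≤ (1 + 2 * K * ρ) ^ (j + 1) :=
        one_le_pow₀ (by linarith [show 0 ≤ 2 * K * ρ by positivity])
      calc _ ≤ |deriv (cocycle (productMap A B) a j) u * (1 + t * a t)| +
              |cocycle (productMap A B) a j u *
              (deriv (fun t => t * a t) t * deriv (productMap A B)^[j] u)| := abs_add_le _ _
        _ ≤ (4 * K * j * (1 + 2 * K * ρ) ^ j) * (1 + 2 * K * ρ) + 2 * (K * 2) := by
            simp only [abs_mul]
            gcongr
            exact ha' _ (hle.trans h2)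
        _ = 4 * K * j * (1 + 2 * K * ρ) ^ (j + 1) + 4 * K * 1 := by ring
        _ ≤ 4 * K * j * (1 + 2 * K * ρ) ^ (j + 1) + 4 * K * (1 + 2 * K * ρ) ^ (j + 1) := by
            gcongr
        _ = _ := by push_cast; ring
  have hjk : (j : ℝ) ≤ k := by exact_mod_cast hj
  calc _ ≤ _ := main
    _ ≤ 4 * K * k * 2 := by
      gcongr
      exact one_add_pow_le_two hK hρ hk hj
    _ = _ := by ring

end Estimates

/-- Uniform estimates for the first `k` iterates on an interval of radius `M |l| ^ k`. -/
theorem exists_cocycle_estimates {A B : ℝ → ℝ} (hA : ContDiff ℝ ∞ A) (hB : ContDiff ℝ ∞ B)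
    (hab : A 0 + B 0 = 0) {l : ℝ} (hl : |l| < 1) {M : ℝ} (hM : 0 ≤ M) :
    ∃ C : ℝ, 0 ≤ C ∧ ∀ᶠ k : ℕ in atTop, ∀ u, |u| ≤ M * |l| ^ k → ∀ j ≤ k,
      |(productMap A B)^[j] u| ≤ C * |l| ^ k ∧
      |cocycle (productMap A B) A j u - 1| ≤ C * (k * |l| ^ k) ∧
      |cocycle (productMap A B) B j u - 1| ≤ C * (k * |l| ^ k) ∧
      |deriv (cocycle (productMap A B) A j) u| ≤ C * k ∧
      |deriv (cocycle (productMap A B) B j) u| ≤ C * k ∧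
      |cocycle (productMap A B) A j u * cocycle (productMap A B) B j u - 1| ≤
        C * (k * |l| ^ k) * |l| ^ k := by
  obtain ⟨K, hK⟩ := exists_cocycleBound hA hB hab
  have hK0 := hK.one_le
  set C := 8 * K * (1 + M + M ^ 2) with hC
  have t1 : Tendsto (fun k : ℕ => 8 * K * M * (k * |l| ^ k)) atTop (𝓝 0) := by
    simpa using (tendsto_self_mul_const_pow_of_abs_lt_one (r := |l|) (by simpa using hl)).const_mul
      (8 * K * M)
  have t2 : Tendsto (fun k : ℕ => 8 * K * M * |l| ^ k) atTop (𝓝 0) := by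
    simpa using (tendsto_pow_atTop_nhds_zero_of_lt_one (abs_nonneg l) hl).const_mul (8 * K * M)
  refine ⟨C, by positivity, ?_⟩
  filter_upwards [t1.eventually (ge_mem_nhds one_pos), t2.eventually (ge_mem_nhds one_pos)]
    with k h1 h2 u hu j hj
  have hρ : 0 ≤ M * |l| ^ k := by positivity
  have hk : 8 * K * k * (M * |l| ^ k) ≤ 1 := by linarith
  have hρ1 : 8 * K * (M * |l| ^ k) ≤ 1 := by linarith
  have hC1 : 8 * K * M ≤ C := by
    rw [hC]; gcongr; nlinarith
  have hC2 : 8 * K ≤ C := by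
    rw [hC]; nlinarith [sq_nonneg M, mul_nonneg (zero_le_one.trans hK0) hM,
      mul_nonneg (zero_le_one.trans hK0) (sq_nonneg M)]
  have hC3 : 8 * K * M ^ 2 ≤ C := by
    rw [hC]; gcongr; linarith
  have hkl : 0 ≤ (k : ℝ) * |l| ^ k := by positivity
  have hll : 0 ≤ |l| ^ k := by positivity
  have hKM : 0 ≤ K * M := by positivity
  have hX : 4 * K * k * (M * |l| ^ k) ≤ C * (k * |l| ^ k) := by
    have : 4 * K * M * (k * |l| ^ k) ≤ C * (k * |l| ^ k) := by
      gcongr; linarith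
    linarith
  refine ⟨?_, ?_, ?_, ?_, ?_, ?_⟩
  · refine (abs_iterate_productMap_le hK hρ hk hρ1 hu hj).trans ?_
    rw [← mul_assoc]
    gcongr
    nlinarith
  · exact (abs_cocycle_sub_one_le hK hρ hk hρ1 hK.fst_le hu hj).trans hX
  · exact (abs_cocycle_sub_one_le hK hρ hk hρ1 hK.snd_le hu hj).trans hX
  · refine (abs_deriv_cocycle_le hA hB hK hρ hk hρ1 hA hK.fst_le hK.fst_deriv_le hu hj).trans ?_
    gcongr
  · refine (abs_deriv_cocycle_le hA hB hK hρ hk hρ1 hB hK.snd_le hK.snd_deriv_le hu hj).trans ?_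
    gcongr
  · refine (abs_cocycle_mul_sub_one_le hK hρ hk hρ1 hu hj).trans ?_
    calc _ = 8 * K * M ^ 2 * (k * |l| ^ k) * |l| ^ k := by ring
      _ ≤ _ := by gcongr

/-! ### Iterates of the normal form -/

theorem iterate_resonantNormalForm (l : ℝ) (A B : ℝ → ℝ) (j : ℕ) (p : ℝ × ℝ) :
    (resonantNormalForm l A B)^[j] p =
      (l ^ j * p.1 * cocycle (productMap A B) A j (p.1 * p.2),
        (1 / l) ^ j * p.2 * cocycle (productMap A B) B j (p.1 * p.2)) := by
  by_cases hl : l = 0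
  · subst hl
    cases j with
    | zero => simp [cocycle]
    | succ j =>
      have h0 : ∀ q : ℝ × ℝ, resonantNormalForm 0 A B q = 0 := fun q => by
        ext <;> simp [resonantNormalForm]
      rw [Function.iterate_succ_apply', h0]
      ext <;> simp
  induction j with
  | zero => simp [cocycle]
  | succ j ih =>
    rw [Function.iterate_succ_apply', ih, resonantNormalForm, cocycle_succ, cocycle_succ]
    have hu := iterate_productMap A B j (p.1 * p.2)
    have hl' : l ^ j * (1 / l) ^ j = 1 := by
      rw [← mul_pow, mul_one_div_cancel hl, one_pow]
    have hprod : (l ^ j * p.1 * cocycle (productMap A B) A j (p.1 * p.2)) *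
        ((1 / l) ^ j * p.2 * cocycle (productMap A B) B j (p.1 * p.2)) =
        (productMap A B)^[j] (p.1 * p.2) := by
      rw [hu]
      linear_combination (p.1 * p.2 * (cocycle (productMap A B) A j (p.1 * p.2) *
        cocycle (productMap A B) B j (p.1 * p.2))) * hl'
    simp only [hprod]
    ext <;> simp only [pow_succ] <;> ring

theorem contDiff_resonantNormalForm (l : ℝ) {A B : ℝ → ℝ} (hA : ContDiff ℝ ∞ A)
    (hB : ContDiff ℝ ∞ B) : ContDiff ℝ ∞ (resonantNormalForm l A B) := by
  unfold resonantNormalForm; fun_prop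

theorem iterate_eventuallyEq {X : Type*} [TopologicalSpace X] {f T : X → X} {N : Set X}
    (hN : IsOpen N) (hT : Continuous T) (hfN : ∀ p ∈ N, f p = T p) {p : X} :
    ∀ {j : ℕ}, (∀ i < j, T^[i] p ∈ N) → f^[j] =ᶠ[𝓝 p] T^[j]
  | 0, _ => EventuallyEq.rfl
  | j + 1, h => by
    have ih := iterate_eventuallyEq hN hT hfN (j := j) fun i hi => h i (by omega)
    filter_upwards [ih, (hT.iterate j).continuousAt.eventually (hN.mem_nhds (h j (by omega)))]
      with q hq hqN
    rw [Function.iterate_succ_apply', Function.iterate_succ_apply', hq, hfN _ hqN]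

theorem hasFDerivAt_cross {P Q : ℝ → ℝ} (hP : ContDiff ℝ ∞ P) (hQ : ContDiff ℝ ∞ Q) (a b : ℝ)
    (p : ℝ × ℝ) : ∃ D : ℝ × ℝ →L[ℝ] ℝ × ℝ,
      HasFDerivAt (fun q : ℝ × ℝ => (a * q.1 * P (q.1 * q.2), b * q.2 * Q (q.1 * q.2))) D p ∧
      D (1, 0) = (a * (P (p.1 * p.2) + p.1 * p.2 * deriv P (p.1 * p.2)),
        b * p.2 ^ 2 * deriv Q (p.1 * p.2)) ∧
      D (0, 1) = (a * p.1 ^ 2 * deriv P (p.1 * p.2),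
        b * (Q (p.1 * p.2) + p.1 * p.2 * deriv Q (p.1 * p.2))) := by
  have h1 : HasFDerivAt (fun q : ℝ × ℝ => q.1) (ContinuousLinearMap.fst ℝ ℝ ℝ) p := hasFDerivAt_fst
  have h2 : HasFDerivAt (fun q : ℝ × ℝ => q.2) (ContinuousLinearMap.snd ℝ ℝ ℝ) p := hasFDerivAt_snd
  have hP' : HasDerivAt P (deriv P (p.1 * p.2)) (p.1 * p.2) :=
    (hP.differentiable (by simp)).differentiableAt.hasDerivAt
  have hQ' : HasDerivAt Q (deriv Q (p.1 * p.2)) (p.1 * p.2) :=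
    (hQ.differentiable (by simp)).differentiableAt.hasDerivAt
  refine ⟨_, ((h1.const_mul a).mul (hP'.comp_hasFDerivAt p (h1.mul h2))).prodMk
    ((h2.const_mul b).mul (hQ'.comp_hasFDerivAt p (h1.mul h2))), ?_, ?_⟩
  · ext <;> simp <;> ring
  · ext <;> simp <;> ring

theorem planarTrace_comp (L D : ℝ × ℝ →L[ℝ] ℝ × ℝ) :
    planarTrace (L.comp D) = (L (1, 0)).1 * (D (1, 0)).1 + (L (0, 1)).1 * (D (1, 0)).2 +
      (L (1, 0)).2 * (D (0, 1)).1 + (L (0, 1)).2 * (D (0, 1)).2 := by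
  rw [planarTrace, ContinuousLinearMap.comp_apply, ContinuousLinearMap.comp_apply,
    planar_apply L (D (1, 0)), planar_apply L (D (0, 1))]
  simp; ring

theorem planarDet_comp (L D : ℝ × ℝ →L[ℝ] ℝ × ℝ) :
    planarDet (L.comp D) = planarDet L * planarDet D := by
  simp only [planarDet]
  rw [ContinuousLinearMap.comp_apply, ContinuousLinearMap.comp_apply,
    planar_apply L (D (1, 0)), planar_apply L (D (0, 1))]
  simp; ring

theorem minimalPeriod_eq_of_ne {X : Type*} {f : X → X} {p : X} {k m : ℕ} (hk : 0 < k) (hmk : m ≤ k)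
    (hp : f^[k + m] p = p) (hne : ∀ n, 0 < n → n ≤ k → f^[n] p ≠ p) :
    Function.minimalPeriod f p = k + m := by
  have hper : Function.IsPeriodicPt f (k + m) p := hp
  have hpos := hper.minimalPeriod_pos (by omega)
  obtain ⟨c, hc⟩ := hper.minimalPeriod_dvd
  rcases Nat.lt_or_ge k (Function.minimalPeriod f p) with h | h
  · have hc1 : c = 1 := by
      have hc0 : c ≠ 0 := by rintro rfl; omega
      by_contra hc1
      have : 2 ≤ c := by omega
      nlinarith
    rw [hc, hc1, mul_one]
  · exact absurd (Function.isPeriodicPt_minimalPeriod f p) (hne _ hpos h)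

/-! ### Excursions near the coordinate axes -/

theorem pow_mul_mem_segment {l : ℝ} (hl : |l| ≤ 1) {S : Set ℝ} (hS : Convex ℝ S) {a : ℝ}
    (h0 : (0 : ℝ) ∈ S) (ha : a ∈ S) (hla : l * a ∈ S) (j : ℕ) : l ^ j * a ∈ S := by
  have hstar : ∀ c ∈ S, ∀ t : ℝ, 0 ≤ t → t ≤ 1 → t * c ∈ S := fun c hc t h1 h2 => by
    simpa using hS h0 hc (sub_nonneg.2 h2) h1 (by ring)
  have hsq : l ^ 2 ≤ 1 := by rw [← sq_abs]; exact pow_le_one₀ (abs_nonneg _) hl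
  rcases Nat.even_or_odd' j with ⟨i, rfl | rfl⟩
  · rw [pow_mul]
    exact hstar a ha _ (by positivity) (pow_le_one₀ (sq_nonneg l) hsq)
  · rw [pow_succ, pow_mul, mul_assoc]
    exact hstar _ hla _ (by positivity) (pow_le_one₀ (sq_nonneg l) hsq)

theorem exists_axes_nhd {l xs ys : ℝ} (hl : |l| < 1) {N : Set (ℝ × ℝ)} (hNopen : IsOpen N)
    (hNconv : Convex ℝ N) (hN0 : (0, 0) ∈ N) (hN1 : (xs, 0) ∈ N) (hN2 : (l * xs, 0) ∈ N)
    (hN3 : (0, l * ys) ∈ N) (hN4 : (0, l * (l * ys)) ∈ N) :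
    ∃ δ > 0, ∃ k₀ : ℕ, ∀ k ≥ k₀, ∀ j < k, ∀ a b : ℝ, |a - xs| < δ → |b - ys| < δ →
      (l ^ j * a, l ^ (k - j) * b) ∈ N := by
  set S : Set (ℝ × ℝ) := {(0, 0), (xs, 0), (l * xs, 0), (0, l * ys), (0, l * (l * ys))} with hS
  have hSN : convexHull ℝ S ⊆ N := by
    refine convexHull_min ?_ hNconv
    rintro p (rfl | rfl | rfl | rfl | rfl) <;> assumption
  have hfin : S.Finite := by simp [hS]
  obtain ⟨δ, hδ, hδN⟩ := (hfin.isCompact_convexHull (𝕜 := ℝ)).exists_thickening_subset_open hNopen hSN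
  have hsub := subset_convexHull ℝ S
  have hcx := (convex_convexHull ℝ S).is_linear_preimage (f := fun t : ℝ => (t, (0 : ℝ)))
    ⟨fun _ _ => by simp, fun _ _ => by simp⟩
  have hcy := (convex_convexHull ℝ S).is_linear_preimage (f := fun t : ℝ => ((0 : ℝ), t))
    ⟨fun _ _ => by simp, fun _ _ => by simp⟩
  have hx : ∀ j : ℕ, (l ^ j * xs, (0 : ℝ)) ∈ convexHull ℝ S := fun j =>
    pow_mul_mem_segment hl.le hcx (hsub (by simp [hS])) (hsub (by simp [hS]))
      (hsub (by simp [hS])) j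
  have hy : ∀ j : ℕ, ((0 : ℝ), l ^ j * (l * ys)) ∈ convexHull ℝ S := fun j =>
    pow_mul_mem_segment hl.le hcy (hsub (by simp [hS])) (hsub (by simp [hS]))
      (hsub (by simp [hS])) j
  set W := |xs| + |ys| + δ with hW
  have hW0 : 0 < W := by positivity
  have ht : Tendsto (fun n : ℕ => |l| ^ n * W) atTop (𝓝 0) := by
    simpa using (tendsto_pow_atTop_nhds_zero_of_lt_one (abs_nonneg l) hl).mul_const W
  obtain ⟨J, hJ⟩ := eventually_atTop.1 (ht.eventually (gt_mem_nhds hδ))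
  have hpow : ∀ n : ℕ, |l ^ n| ≤ 1 := fun n => by
    rw [abs_pow]; exact pow_le_one₀ (abs_nonneg l) hl.le
  refine ⟨δ, hδ, 2 * J, fun k hk j hj a b ha hb => hδN (Metric.mem_thickening_iff.2 ?_)⟩
  have haW : |a| ≤ W := by
    have := abs_sub_abs_le_abs_sub a xs
    linarith [abs_nonneg ys]
  have hbW : |b| ≤ W := by
    have := abs_sub_abs_le_abs_sub b ys
    linarith [abs_nonneg xs]
  have hsmall : ∀ n ≥ J, ∀ c : ℝ, |c| ≤ W → |l ^ n * c| < δ := fun n hn c hc => by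
    rw [abs_mul, abs_pow]
    exact (mul_le_mul_of_nonneg_left hc (by positivity)).trans_lt (hJ n hn)
  have hclose : ∀ (n : ℕ) (c d : ℝ), |c - d| < δ → |l ^ n * c - l ^ n * d| < δ :=
    fun n c d h => by
      rw [← mul_sub, abs_mul]
      exact (mul_le_of_le_one_left (abs_nonneg _) (hpow n)).trans_lt h
  rcases Nat.lt_or_ge (k - j) J with h | h
  · refine ⟨_, hy (k - j - 1), ?_⟩
    rw [← mul_assoc, ← pow_succ, Nat.sub_add_cancel (by omega), Prod.dist_eq, Real.dist_eq,
      Real.dist_eq, sub_zero]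
    exact max_lt (hsmall j (by omega) a haW) (hclose _ _ _ hb)
  · refine ⟨_, hx j, ?_⟩
    rw [Prod.dist_eq, Real.dist_eq, Real.dist_eq, sub_zero]
    exact max_lt (hclose _ _ _ ha) (hsmall _ h b hbW)

/-! ### Taylor expansions along sequences -/

theorem fderiv_fderiv_apply {g : ℝ × ℝ → ℝ} (hg : ContDiff ℝ ∞ g) (P v w : ℝ × ℝ) :
    fderiv ℝ (fun q => fderiv ℝ g q v) P w = fderiv ℝ (fderiv ℝ g) P w v := by
  have h : DifferentiableAt ℝ (fderiv ℝ g) P :=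
    ((hg.fderiv_right (m := ∞) (by simp)).differentiable (by simp)).differentiableAt
  rw [fderiv_clm_apply h (differentiableAt_const v)]
  simp

theorem contDiff_partialX {g : ℝ × ℝ → ℝ} (hg : ContDiff ℝ ∞ g) : ContDiff ℝ ∞ (partialX g) :=
  (hg.fderiv_right (m := ∞) (by simp)).clm_apply contDiff_const

theorem contDiff_partialY {g : ℝ × ℝ → ℝ} (hg : ContDiff ℝ ∞ g) : ContDiff ℝ ∞ (partialY g) :=
  (hg.fderiv_right (m := ∞) (by simp)).clm_apply contDiff_const

theorem partialY_partialX {g : ℝ × ℝ → ℝ} (hg : ContDiff ℝ ∞ g) (P : ℝ × ℝ) :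
    partialY (partialX g) P = partialX (partialY g) P := by
  have hs : IsSymmSndFDerivAt ℝ g P := hg.contDiffAt.isSymmSndFDerivAt
    (by rw [minSmoothness_of_isRCLikeNormedField]; exact WithTop.coe_le_coe.2 le_top)
  exact (fderiv_fderiv_apply hg P _ _).trans
    ((hs.eq _ _).trans (fderiv_fderiv_apply hg P _ _).symm)

theorem fderiv_apply_partial (g : ℝ × ℝ → ℝ) (P z : ℝ × ℝ) :
    fderiv ℝ g P z = partialX g P * z.1 + partialY g P * z.2 := by
  rw [planar_apply (fderiv ℝ g P) z, partialX, partialY, smul_eq_mul, smul_eq_mul]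
  ring

theorem isLittleO_taylor_one {g : ℝ × ℝ → ℝ} (hg : ContDiff ℝ ∞ g) (P : ℝ × ℝ) :
    (fun z : ℝ × ℝ => g (P + z) - g P - (partialX g P * z.1 + partialY g P * z.2))
      =o[𝓝 0] fun z => z := by
  have h := (hasFDerivAt_iff_isLittleO_nhds_zero.1
    ((hg.differentiable (by simp)).differentiableAt (x := P)).hasFDerivAt)
  simpa only [fderiv_apply_partial] using h

theorem norm_planar_le (L : ℝ × ℝ →L[ℝ] ℝ) : ‖L‖ ≤ |L (1, 0)| + |L (0, 1)| := by
  refine L.opNorm_le_bound (by positivity) fun z => ?_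
  rw [planar_apply L z, smul_eq_mul, smul_eq_mul]
  calc ‖z.1 * L (1, 0) + z.2 * L (0, 1)‖ ≤ ‖z.1‖ * |L (1, 0)| + ‖z.2‖ * |L (0, 1)| := by
        simpa only [norm_mul, Real.norm_eq_abs] using norm_add_le (z.1 * L (1, 0)) (z.2 * L (0, 1))
    _ ≤ ‖z‖ * |L (1, 0)| + ‖z‖ * |L (0, 1)| := by
        gcongr
        exacts [norm_fst_le z, norm_snd_le z]
    _ = _ := by ring

theorem isLittleO_taylor_two {g : ℝ × ℝ → ℝ} (hg : ContDiff ℝ ∞ g) (P : ℝ × ℝ) :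
    (fun z : ℝ × ℝ => g (P + z) - g P - (partialX g P * z.1 + partialY g P * z.2) -
      (partialX (partialX g) P / 2 * z.1 ^ 2 + partialX (partialY g) P * z.1 * z.2 +
        partialY (partialY g) P / 2 * z.2 ^ 2)) =o[𝓝 0] fun z => ‖z‖ ^ 2 := by
  rw [Asymptotics.isLittleO_iff]
  intro c hc
  have hx := (isLittleO_taylor_one (contDiff_partialX hg) P).def (half_pos hc)
  have hy := (isLittleO_taylor_one (contDiff_partialY hg) P).def (half_pos hc)
  rw [partialY_partialX hg] at hx
  set a := partialX (partialX g) P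
  set b := partialX (partialY g) P
  set d := partialY (partialY g) P
  set R : ℝ × ℝ → ℝ := fun z => g (P + z) - g P - (partialX g P * z.1 + partialY g P * z.2) -
      (a / 2 * z.1 ^ 2 + b * z.1 * z.2 + d / 2 * z.2 ^ 2) with hR
  have hder : ∀ z : ℝ × ℝ, ∃ D : ℝ × ℝ →L[ℝ] ℝ, HasFDerivAt R D z ∧
      D (1, 0) = partialX g (P + z) - partialX g P - (a * z.1 + b * z.2) ∧
      D (0, 1) = partialY g (P + z) - partialY g P - (b * z.1 + d * z.2) := by
    intro z
    have h1 : HasFDerivAt (fun q : ℝ × ℝ => q.1) (ContinuousLinearMap.fst ℝ ℝ ℝ) z :=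
      hasFDerivAt_fst
    have h2 : HasFDerivAt (fun q : ℝ × ℝ => q.2) (ContinuousLinearMap.snd ℝ ℝ ℝ) z :=
      hasFDerivAt_snd
    have h3 : HasFDerivAt (fun q : ℝ × ℝ => g (P + q)) (fderiv ℝ g (P + z)) z := by
      rw [hasFDerivAt_comp_add_left]
      exact ((hg.differentiable (by simp)).differentiableAt).hasFDerivAt
    refine ⟨_, ((h3.sub_const (g P)).sub ((h1.const_mul (partialX g P)).add
      (h2.const_mul (partialY g P)))).sub ((((h1.pow 2).const_mul (a / 2)).add
      ((h1.const_mul b).mul h2)).add ((h2.pow 2).const_mul (d / 2))), ?_, ?_⟩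
    · simp [partialX]; ring
    · simp [partialY]; ring
  obtain ⟨r, hr, h⟩ := Metric.eventually_nhds_iff.1 (hx.and hy)
  rw [Metric.eventually_nhds_iff]
  refine ⟨r, hr, fun z hz => ?_⟩
  rw [dist_zero_right] at hz
  choose D hD hD1 hD2 using hder
  have hbound : ∀ q ∈ Metric.closedBall (0 : ℝ × ℝ) ‖z‖, ‖D q‖ ≤ c * ‖z‖ := by
    intro q hq
    rw [mem_closedBall_zero_iff] at hq
    have hq' := h (y := q) (by rw [dist_zero_right]; linarith)
    refine (norm_planar_le _).trans ?_
    rw [hD1, hD2]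
    simp only [Real.norm_eq_abs] at hq'
    have : c / 2 * ‖q‖ ≤ c / 2 * ‖z‖ := by gcongr
    linarith [hq'.1, hq'.2]
  have hmv := (convex_closedBall (0 : ℝ × ℝ) ‖z‖).norm_image_sub_le_of_norm_hasFDerivWithin_le
    (fun q _ => (hD q).hasFDerivWithinAt) hbound (x := 0) (y := z) (by simp) (by simp)
  have hR0 : R 0 = 0 := by simp [hR]
  rw [hR0, sub_zero, sub_zero] at hmv
  rw [norm_pow, norm_norm]
  calc ‖R z‖ ≤ c * ‖z‖ * ‖z‖ := hmv
    _ = _ := by ring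

section Sequences

variable {e : ℕ → ℝ} {z : ℕ → ℝ × ℝ} {ξ w : ℝ}

theorem tendsto_zero_of_div (he : Tendsto e atTop (𝓝 0)) (he0 : ∀ k, e k ≠ 0) {v : ℕ → ℝ}
    (hv : Tendsto (fun k => v k / e k) atTop (𝓝 ξ)) : Tendsto v atTop (𝓝 0) := by
  have := hv.mul he
  simpa [div_mul_cancel₀ _ (he0 _)] using this

theorem isBigO_of_div (he0 : ∀ k, e k ≠ 0)
    (h1 : Tendsto (fun k => (z k).1 / e k) atTop (𝓝 ξ))
    (h2 : Tendsto (fun k => (z k).2 / e k) atTop (𝓝 w)) : z =O[atTop] e := by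
  have a1 : (fun k => (z k).1) =O[atTop] e :=
    (Asymptotics.isBigO_of_div_tendsto_nhds (.of_forall fun k h => absurd h (he0 k)) ξ h1)
  have a2 : (fun k => (z k).2) =O[atTop] e :=
    (Asymptotics.isBigO_of_div_tendsto_nhds (.of_forall fun k h => absurd h (he0 k)) w h2)
  exact a1.prod_left a2

theorem tendsto_of_div (he : Tendsto e atTop (𝓝 0)) (he0 : ∀ k, e k ≠ 0)
    (h1 : Tendsto (fun k => (z k).1 / e k) atTop (𝓝 ξ))
    (h2 : Tendsto (fun k => (z k).2 / e k) atTop (𝓝 w)) : Tendsto z atTop (𝓝 0) :=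
  (tendsto_zero_of_div he he0 h1).prodMk_nhds (tendsto_zero_of_div he he0 h2)

theorem tendsto_taylor_one {g : ℝ × ℝ → ℝ} (hg : ContDiff ℝ ∞ g) (P : ℝ × ℝ)
    (he : Tendsto e atTop (𝓝 0)) (he0 : ∀ k, e k ≠ 0)
    (h1 : Tendsto (fun k => (z k).1 / e k) atTop (𝓝 ξ))
    (h2 : Tendsto (fun k => (z k).2 / e k) atTop (𝓝 w)) :
    Tendsto (fun k => (g (P + z k) - g P) / e k) atTop
      (𝓝 (partialX g P * ξ + partialY g P * w)) := by
  have h3 := (((isLittleO_taylor_one hg P).comp_tendsto (tendsto_of_div he he0 h1 h2)).trans_isBigO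
    (isBigO_of_div he0 h1 h2)).tendsto_div_nhds_zero
  have h4 := h3.add ((h1.const_mul (partialX g P)).add (h2.const_mul (partialY g P)))
  rw [zero_add] at h4
  refine h4.congr fun k => ?_
  simp only [Function.comp_apply]
  ring

theorem tendsto_taylor_two {g : ℝ × ℝ → ℝ} (hg : ContDiff ℝ ∞ g) (P : ℝ × ℝ)
    (he : Tendsto e atTop (𝓝 0)) (he0 : ∀ k, e k ≠ 0)
    (h1 : Tendsto (fun k => (z k).1 / e k) atTop (𝓝 ξ))
    (h2 : Tendsto (fun k => (z k).2 / e k) atTop (𝓝 w)) :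
    Tendsto (fun k => (g (P + z k) - g P - (partialX g P * (z k).1 + partialY g P * (z k).2)) /
      e k ^ 2) atTop (𝓝 (partialX (partialX g) P / 2 * ξ ^ 2 + partialX (partialY g) P * ξ * w +
        partialY (partialY g) P / 2 * w ^ 2)) := by
  have h3 := (((isLittleO_taylor_two hg P).comp_tendsto (tendsto_of_div he he0 h1 h2)).trans_isBigO
    ((isBigO_of_div he0 h1 h2).norm_left.pow 2)).tendsto_div_nhds_zero
  have h4 := h3.add ((((h1.pow 2).const_mul (partialX (partialX g) P / 2)).add
    ((h1.const_mul (partialX (partialY g) P)).mul h2)).add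
    ((h2.pow 2).const_mul (partialY (partialY g) P / 2)))
  rw [zero_add] at h4
  refine h4.congr fun k => ?_
  have := he0 k
  simp only [Function.comp_apply]
  field_simp
  ring

end Sequences

/-! ### Limits of the cocycle along sequences of size `|l| ^ k` -/

theorem tendsto_cocycle {A B : ℝ → ℝ} (hA : ContDiff ℝ ∞ A) (hB : ContDiff ℝ ∞ B)
    (hab : A 0 + B 0 = 0) {l : ℝ} (hl0 : 0 < |l|) (hl : |l| < 1) {M : ℝ} (hM : 0 ≤ M) {u : ℕ → ℝ}
    (hu : ∀ᶠ k in atTop, |u k| ≤ M * |l| ^ k) :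
    Tendsto (fun k => cocycle (productMap A B) A k (u k)) atTop (𝓝 1) ∧
    Tendsto (fun k => cocycle (productMap A B) B k (u k)) atTop (𝓝 1) ∧
    Tendsto (fun k => l ^ k * deriv (cocycle (productMap A B) A k) (u k)) atTop (𝓝 0) ∧
    Tendsto (fun k => l ^ k * deriv (cocycle (productMap A B) B k) (u k)) atTop (𝓝 0) ∧
    Tendsto (fun k => (cocycle (productMap A B) A k (u k) * cocycle (productMap A B) B k (u k)
      - 1) / l ^ k) atTop (𝓝 0) := by
  obtain ⟨C, hC, h⟩ := exists_cocycle_estimates hA hB hab hl hM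
  have t : Tendsto (fun k : ℕ => C * (k * |l| ^ k)) atTop (𝓝 0) := by
    simpa using (tendsto_self_mul_const_pow_of_abs_lt_one (r := |l|) (by simpa using hl)).const_mul C
  have key : ∀ v : ℕ → ℝ, (∀ᶠ k : ℕ in atTop, |v k| ≤ C * (k * |l| ^ k)) →
      Tendsto v atTop (𝓝 0) := fun v hv => squeeze_zero_norm' hv t
  have hE := hu.and h
  refine ⟨?_, ?_, key _ ?_, key _ ?_, key _ ?_⟩
  · refine tendsto_sub_nhds_zero_iff.1 (key _ ?_)
    filter_upwards [hE] with k hk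
    exact (hk.2 _ hk.1 k le_rfl).2.1
  · refine tendsto_sub_nhds_zero_iff.1 (key _ ?_)
    filter_upwards [hE] with k hk
    exact (hk.2 _ hk.1 k le_rfl).2.2.1
  · filter_upwards [hE] with k hk
    rw [abs_mul, abs_pow]
    calc _ ≤ |l| ^ k * (C * k) := by
          gcongr
          exact (hk.2 _ hk.1 k le_rfl).2.2.2.1
      _ = _ := by ring
  · filter_upwards [hE] with k hk
    rw [abs_mul, abs_pow]
    calc _ ≤ |l| ^ k * (C * k) := by
          gcongr
          exact (hk.2 _ hk.1 k le_rfl).2.2.2.2.1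
      _ = _ := by ring
  · filter_upwards [hE] with k hk
    rw [abs_div, abs_pow, div_le_iff₀ (by positivity)]
    exact (hk.2 _ hk.1 k le_rfl).2.2.2.2.2

/-! ### Single-round periodic points: existence -/

/-- The data of a smooth return map `T` from `(0, ys)` to `(xs, 0)` together with a resonant
normal form whose resonant terms cancel at leading order. -/
structure ReturnData (l xs ys : ℝ) (A B : ℝ → ℝ) (T : ℝ × ℝ → ℝ × ℝ) : Prop where
  abs_pos : 0 < |l|
  abs_lt_one : |l| < 1
  contDiff_fst : ContDiff ℝ ∞ A
  contDiff_snd : ContDiff ℝ ∞ B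
  sum_eq_zero : A 0 + B 0 = 0
  contDiff_map : ContDiff ℝ ∞ T
  map_eq : T (0, ys) = (xs, 0)

/-- The point with scaled coordinates `(X, w)` near `(0, ys)`. -/
noncomputable def scaledPoint (l ys : ℝ) (k : ℕ) (X w : ℝ) : ℝ × ℝ := (0, ys) + (l ^ k * X, l ^ k * w)

/-- The product of the coordinates of `T` at a scaled point. -/
noncomputable def scaledProd (T : ℝ × ℝ → ℝ × ℝ) (l ys : ℝ) (k : ℕ) (X w : ℝ) : ℝ :=
  (T (scaledPoint l ys k X w)).1 * (T (scaledPoint l ys k X w)).2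

/-- The first coordinate, in scaled form, of the return map. -/
noncomputable def scaledFst (A B : ℝ → ℝ) (T : ℝ × ℝ → ℝ × ℝ) (l ys : ℝ) (k : ℕ) (X w : ℝ) : ℝ :=
  (T (scaledPoint l ys k X w)).1 * cocycle (productMap A B) A k (scaledProd T l ys k X w)

/-- The displacement of the second coordinate, in scaled form, under the return map. -/
noncomputable def scaledSnd (A B : ℝ → ℝ) (T : ℝ × ℝ → ℝ × ℝ) (l ys : ℝ) (k : ℕ) (X w : ℝ) : ℝ :=
  ((T (scaledPoint l ys k X w)).2 * cocycle (productMap A B) B k (scaledProd T l ys k X w) / l ^ k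
    - ys) / l ^ k - w

theorem exists_fixed_curve {Ψ : ℝ → ℝ → ℝ} {R W : ℝ} (hR : 0 ≤ R)
    (hb : ∀ X w, |X| ≤ R → |w| ≤ W → |Ψ X w| ≤ R)
    (hl : ∀ X X' w w', |X| ≤ R → |X'| ≤ R → |w| ≤ W → |w'| ≤ W →
      |Ψ X w - Ψ X' w'| ≤ 1 / 2 * (|X - X'| + |w - w'|)) :
    ∃ ξ : ℝ → ℝ, ContinuousOn ξ (Set.Icc (-W) W) ∧
      ∀ w, |w| ≤ W → |ξ w| ≤ R ∧ Ψ (ξ w) w = ξ w := by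
  have hex : ∀ w, ∃ X, |w| ≤ W → |X| ≤ R ∧ Ψ X w = X := by
    intro w
    by_cases hw : |w| ≤ W
    · have hc : ContinuousOn (fun X => Ψ X w) (Set.Icc (-R) R) := by
        have : LipschitzOnWith (1 / 2) (fun X => Ψ X w) (Set.Icc (-R) R) :=
          LipschitzOnWith.of_dist_le_mul fun X hX X' hX' => by
            have := hl X X' w w (abs_le.2 hX) (abs_le.2 hX') hw hw
            rw [Real.dist_eq, Real.dist_eq]
            simpa using this
        exact this.continuousOn
      obtain ⟨X, hX, hfix⟩ := exists_mem_Icc_isFixedPt_of_mapsTo hc (by linarith)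
        fun X hX => abs_le.1 (hb X w (abs_le.2 hX) hw)
      exact ⟨X, fun _ => ⟨abs_le.2 hX, hfix⟩⟩
    · exact ⟨0, fun h => absurd h hw⟩
  choose ξ hξ using hex
  refine ⟨ξ, ?_, hξ⟩
  have : LipschitzOnWith 1 ξ (Set.Icc (-W) W) :=
    LipschitzOnWith.of_dist_le_mul fun w hw w' hw' => by
      have h1 := hξ w (abs_le.2 hw)
      have h2 := hξ w' (abs_le.2 hw')
      have := hl (ξ w) (ξ w') w w' h1.1 h2.1 (abs_le.2 hw) (abs_le.2 hw')
      rw [h1.2, h2.2] at this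
      rw [Real.dist_eq, Real.dist_eq]
      simp only [NNReal.coe_one, one_mul]
      linarith
  exact this.continuousOn

namespace ReturnData

variable {l xs ys : ℝ} {A B : ℝ → ℝ} {T : ℝ × ℝ → ℝ × ℝ}

theorem ne_zero (D : ReturnData l xs ys A B T) : l ≠ 0 := _root_.abs_pos.1 D.abs_pos

theorem tendsto_pow (D : ReturnData l xs ys A B T) : Tendsto (fun k : ℕ => l ^ k) atTop (𝓝 0) :=
  tendsto_pow_atTop_nhds_zero_of_abs_lt_one D.abs_lt_one

theorem tendsto_abs_pow (D : ReturnData l xs ys A B T) : Tendsto (fun k : ℕ => |l| ^ k) atTop (𝓝 0) :=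
  tendsto_pow_atTop_nhds_zero_of_lt_one (abs_nonneg l) D.abs_lt_one

/-- Uniform bounds on a box in scaled coordinates. -/
theorem exists_box_bounds (D : ReturnData l xs ys A B T) (R : ℝ) :
    ∃ K : ℝ, 0 ≤ K ∧ ∀ᶠ k : ℕ in atTop, ∀ X w, |X| ≤ R → |w| ≤ R →
      |(T (scaledPoint l ys k X w)).1| ≤ |xs| + 1 ∧
      |(T (scaledPoint l ys k X w)).2| ≤ K * |l| ^ k ∧
      ∀ X' w', |X'| ≤ R → |w'| ≤ R →
        |(T (scaledPoint l ys k X w)).1 - (T (scaledPoint l ys k X' w')).1| ≤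
          K * |l| ^ k * (|X - X'| + |w - w'|) ∧
        |(T (scaledPoint l ys k X w)).2 - (T (scaledPoint l ys k X' w')).2| ≤
          K * |l| ^ k * (|X - X'| + |w - w'|) := by
  rcases lt_or_ge R 0 with hR | hR
  · exact ⟨0, le_rfl, .of_forall fun k X w hX =>
      absurd ((abs_nonneg X).trans hX) (not_le.2 hR)⟩
  obtain ⟨L, t, ht, hL⟩ := (D.contDiff_map.of_le (m := 1) (by simp)).contDiffAt
    (x := ((0 : ℝ), ys)).exists_lipschitzOnWith
  obtain ⟨δ, hδ, hδt⟩ := Metric.mem_nhds_iff.1 ht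
  have hLR : 0 ≤ (L : ℝ) * (2 * R) := by positivity
  have e1 : Tendsto (fun k : ℕ => |l| ^ k * (2 * R)) atTop (𝓝 0) := by
    simpa using D.tendsto_abs_pow.mul_const (2 * R)
  have e2 : Tendsto (fun k : ℕ => L * (2 * R) * |l| ^ k) atTop (𝓝 0) := by
    simpa using D.tendsto_abs_pow.const_mul (L * (2 * R))
  refine ⟨L * (2 * R) + L, by positivity, ?_⟩
  filter_upwards [e1.eventually (gt_mem_nhds hδ), e2.eventually (ge_mem_nhds one_pos)]
    with k hk1 hk2
  have hdist : ∀ X w X' w', dist (scaledPoint l ys k X w) (scaledPoint l ys k X' w') ≤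
      |l| ^ k * (|X - X'| + |w - w'|) := fun X w X' w' => by
    rw [scaledPoint, scaledPoint, dist_add_left, Prod.dist_eq, Real.dist_eq, Real.dist_eq]
    simp only [← mul_sub, abs_mul, abs_pow]
    refine max_le ?_ ?_ <;> gcongr <;> simp
  have h0 : scaledPoint l ys k 0 0 = (0, ys) := by simp [scaledPoint]
  have hmem : ∀ X w, |X| ≤ R → |w| ≤ R → scaledPoint l ys k X w ∈ t := fun X w hX hw => by
    refine hδt ?_
    rw [Metric.mem_ball, ← h0]
    refine (hdist _ _ _ _).trans_lt (lt_of_le_of_lt ?_ hk1)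
    gcongr
    simp only [sub_zero]
    linarith
  have hT : ∀ X w X' w', |X| ≤ R → |w| ≤ R → |X'| ≤ R → |w'| ≤ R →
      dist (T (scaledPoint l ys k X w)) (T (scaledPoint l ys k X' w')) ≤
        L * |l| ^ k * (|X - X'| + |w - w'|) := fun X w X' w' hX hw hX' hw' => by
    refine (hL.dist_le_mul _ (hmem X w hX hw) _ (hmem X' w' hX' hw')).trans ?_
    rw [mul_assoc]
    gcongr
    exact hdist _ _ _ _
  intro X w hX hw
  have hc := hT X w 0 0 hX hw (by simpa) (by simpa)
  rw [h0, D.map_eq, sub_zero, sub_zero, Prod.dist_eq, Real.dist_eq, Real.dist_eq, sub_zero,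
    max_le_iff] at hc
  have hc' : L * |l| ^ k * (|X| + |w|) ≤ L * (2 * R) * |l| ^ k := by
    calc _ ≤ L * |l| ^ k * (2 * R) := by gcongr; linarith
      _ = _ := by ring
  refine ⟨?_, ?_, fun X' w' hX' hw' => ?_⟩
  · have := abs_sub_abs_le_abs_sub (T (scaledPoint l ys k X w)).1 xs
    linarith
  · have : L * (2 * R) * |l| ^ k ≤ (L * (2 * R) + L) * |l| ^ k := by gcongr; simp
    linarith
  · have hd := hT X w X' w' hX hw hX' hw'
    rw [Prod.dist_eq, Real.dist_eq, Real.dist_eq, max_le_iff] at hd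
    have : L * |l| ^ k * (|X - X'| + |w - w'|) ≤
        (L * (2 * R) + L) * |l| ^ k * (|X - X'| + |w - w'|) := by gcongr; linarith
    exact ⟨hd.1.trans this, hd.2.trans this⟩

theorem exists_prod_bound (D : ReturnData l xs ys A B T) (R : ℝ) :
    ∃ M : ℝ, 0 ≤ M ∧ ∀ᶠ k : ℕ in atTop, ∀ X w, |X| ≤ R → |w| ≤ R →
      |scaledProd T l ys k X w| ≤ M * |l| ^ k := by
  obtain ⟨K, hK, h⟩ := D.exists_box_bounds R
  refine ⟨(|xs| + 1) * K, by positivity, ?_⟩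
  filter_upwards [h] with k hk X w hX hw
  obtain ⟨h1, h2, -⟩ := hk X w hX hw
  rw [scaledProd, abs_mul, mul_assoc]
  gcongr

/-- The first scaled equation can be solved for `X` as a continuous function of `w`. -/
theorem exists_scaledFst_curve (D : ReturnData l xs ys A B T) (W : ℝ) :
    ∃ (R : ℝ) (ξ : ℕ → ℝ → ℝ), ∀ᶠ k : ℕ in atTop,
      ContinuousOn (ξ k) (Set.Icc (-W) W) ∧
      ∀ w, |w| ≤ W → |ξ k w| ≤ R ∧ scaledFst A B T l ys k (ξ k w) w = ξ k w := by
  set R := 2 * (|xs| + 1) + |W| with hRdef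
  have hR0 : 0 ≤ R := by positivity
  have hWR : W ≤ R := by linarith [le_abs_self W, abs_nonneg xs]
  refine ⟨R, ?_⟩
  obtain ⟨K, hK, hbox⟩ := D.exists_box_bounds R
  obtain ⟨M, hM, hprod⟩ := D.exists_prod_bound R
  obtain ⟨C, hC, hcoc⟩ := exists_cocycle_estimates D.contDiff_fst D.contDiff_snd D.sum_eq_zero
    D.abs_lt_one hM
  have t1 : Tendsto (fun k : ℕ => C * (k * |l| ^ k)) atTop (𝓝 0) := by
    simpa using (tendsto_self_mul_const_pow_of_abs_lt_one (r := |l|)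
      (by simpa using D.abs_lt_one)).const_mul C
  have t2 : Tendsto (fun k : ℕ => K * |l| ^ k * 2 + (|xs| + 1) *
      ((C * (k * |l| ^ k)) * ((|xs| + 1) * K + K * |l| ^ k * K))) atTop (𝓝 0) := by
    have e := D.tendsto_abs_pow.const_mul K
    have := (e.mul_const 2).add ((t1.mul ((e.mul_const K).const_add ((|xs| + 1) * K))).const_mul
      (|xs| + 1))
    simpa using this
  refine Eventually.choice (r := fun (k : ℕ) (ξ : ℝ → ℝ) => ContinuousOn ξ (Set.Icc (-W) W) ∧
      ∀ w, |w| ≤ W → |ξ w| ≤ R ∧ scaledFst A B T l ys k (ξ w) w = ξ w) ?_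
  filter_upwards [hbox, hprod, hcoc, t1.eventually (ge_mem_nhds one_pos),
    t2.eventually (ge_mem_nhds one_half_pos)] with k hb hp hc h1 h2
  have hP2 : ∀ X w, |X| ≤ R → |w| ≤ R →
      |cocycle (productMap A B) A k (scaledProd T l ys k X w)| ≤ 2 := fun X w hX hw => by
    have h3 := (hc _ (hp X w hX hw) k le_rfl).2.1
    have := abs_sub_abs_le_abs_sub (cocycle (productMap A B) A k (scaledProd T l ys k X w)) 1
    rw [abs_one] at this
    linarith
  have hPL : ∀ u v, |u| ≤ M * |l| ^ k → |v| ≤ M * |l| ^ k →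
      |cocycle (productMap A B) A k u - cocycle (productMap A B) A k v| ≤ C * k * |u - v| :=
    fun u v hu hv => by
      have hφ := contDiff_productMap D.contDiff_fst D.contDiff_snd
      exact (convex_Icc (-(M * |l| ^ k)) (M * |l| ^ k)).norm_image_sub_le_of_norm_deriv_le
        (fun x _ => ((contDiff_cocycle hφ D.contDiff_fst k).differentiable (by simp)).differentiableAt)
        (fun x hx => (hc x (abs_le.2 hx) k le_rfl).2.2.2.1) (abs_le.1 hv) (abs_le.1 hu)
  refine exists_fixed_curve hR0 (fun X w hX hw => ?_) fun X X' w w' hX hX' hw hw' => ?_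
  · rw [scaledFst, abs_mul]
    have := mul_le_mul (hb X w hX (hw.trans hWR)).1 (hP2 X w hX (hw.trans hWR)) (abs_nonneg _)
      (by positivity)
    linarith [abs_nonneg W]
  · replace hw := hw.trans hWR
    replace hw' := hw'.trans hWR
    obtain ⟨f1, g1, hd⟩ := hb X w hX hw
    obtain ⟨hdf, hdg⟩ := hd X' w' hX' hw'
    obtain ⟨f2, g2, -⟩ := hb X' w' hX' hw'
    have hq := hPL _ _ (hp X w hX hw) (hp X' w' hX' hw')
    have hP := hP2 X w hX hw
    rw [scaledFst, scaledFst]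
    set d := |X - X'| + |w - w'| with hd
    have hd0 : 0 ≤ d := by positivity
    set x := (T (scaledPoint l ys k X w)).1
    set x' := (T (scaledPoint l ys k X' w')).1
    have hu : |scaledProd T l ys k X w - scaledProd T l ys k X' w'| ≤
        ((|xs| + 1) * (K * |l| ^ k) + K * |l| ^ k * (K * |l| ^ k)) * d := by
      rw [scaledProd, scaledProd]
      set y := (T (scaledPoint l ys k X w)).2
      set y' := (T (scaledPoint l ys k X' w')).2
      calc |x * y - x' * y'| = |x * (y - y') + y' * (x - x')| := by ring_nf
        _ ≤ |x * (y - y')| + |y' * (x - x')| := abs_add_le _ _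
        _ = |x| * |y - y'| + |y'| * |x - x'| := by rw [abs_mul, abs_mul]
        _ ≤ (|xs| + 1) * (K * |l| ^ k * d) + K * |l| ^ k * (K * |l| ^ k * d) := by gcongr
        _ = _ := by ring
    set P := cocycle (productMap A B) A k (scaledProd T l ys k X w)
    set P' := cocycle (productMap A B) A k (scaledProd T l ys k X' w')
    calc |x * P - x' * P'| = |(x - x') * P + x' * (P - P')| := by ring_nf
      _ ≤ |(x - x') * P| + |x' * (P - P')| := abs_add_le _ _
      _ = |x - x'| * |P| + |x'| * |P - P'| := by rw [abs_mul, abs_mul]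
      _ ≤ K * |l| ^ k * d * 2 + (|xs| + 1) * (C * k *
          (((|xs| + 1) * (K * |l| ^ k) + K * |l| ^ k * (K * |l| ^ k)) * d)) := by
        gcongr
        exact hq.trans (by gcongr)
      _ = (K * |l| ^ k * 2 + (|xs| + 1) *
          ((C * (k * |l| ^ k)) * ((|xs| + 1) * K + K * |l| ^ k * K))) * d := by ring
      _ ≤ 1 / 2 * d := by gcongr

end ReturnData

namespace ReturnData

variable {l xs ys : ℝ} {A B : ℝ → ℝ} {T : ℝ × ℝ → ℝ × ℝ}

theorem contDiff_T_fst (D : ReturnData l xs ys A B T) : ContDiff ℝ ∞ fun q => (T q).1 :=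
  _root_.contDiff_fst.comp D.contDiff_map

theorem contDiff_T_snd (D : ReturnData l xs ys A B T) : ContDiff ℝ ∞ fun q => (T q).2 :=
  _root_.contDiff_snd.comp D.contDiff_map

theorem pow_ne_zero (D : ReturnData l xs ys A B T) (k : ℕ) : l ^ k ≠ 0 :=
  _root_.pow_ne_zero k D.ne_zero

section Limits

variable {X w : ℕ → ℝ} {R w₀ : ℝ}

theorem exists_prod_bound_seq (D : ReturnData l xs ys A B T) (hX : ∀ᶠ k in atTop, |X k| ≤ R)
    (hw : Tendsto w atTop (𝓝 w₀)) :
    ∃ M : ℝ, 0 ≤ M ∧ ∀ᶠ k : ℕ in atTop, |scaledProd T l ys k (X k) (w k)| ≤ M * |l| ^ k := by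
  obtain ⟨M, hM, h⟩ := D.exists_prod_bound (max R (|w₀| + 1))
  refine ⟨M, hM, ?_⟩
  filter_upwards [h, hX, hw.abs.eventually (ge_mem_nhds (lt_add_one _))] with k hk h1 h2
  exact hk _ _ (h1.trans (le_max_left _ _)) (h2.trans (le_max_right _ _))

theorem tendsto_scaledPoint (D : ReturnData l xs ys A B T) (hX : ∀ᶠ k in atTop, |X k| ≤ R)
    (hw : Tendsto w atTop (𝓝 w₀)) :
    Tendsto (fun k => scaledPoint l ys k (X k) (w k)) atTop (𝓝 (0, ys)) := by
  have h1 : Tendsto (fun k => l ^ k * X k) atTop (𝓝 0) := by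
    have := bdd_le_mul_tendsto_zero' R (hX.mono fun k hk => hk) D.tendsto_pow
    simpa [mul_comm] using this
  have h2 : Tendsto (fun k => l ^ k * w k) atTop (𝓝 0) := by
    simpa using D.tendsto_pow.mul hw
  simpa [scaledPoint] using (h1.prodMk_nhds h2).const_add ((0 : ℝ), ys)

theorem tendsto_fst (D : ReturnData l xs ys A B T) (hX : ∀ᶠ k in atTop, |X k| ≤ R)
    (hw : Tendsto w atTop (𝓝 w₀)) :
    Tendsto (fun k => T (scaledPoint l ys k (X k) (w k))) atTop (𝓝 (xs, 0)) := by
  have := (D.contDiff_map.continuous.tendsto (0, ys)).comp (D.tendsto_scaledPoint hX hw)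
  rwa [D.map_eq] at this

theorem tendsto_scaled_abscissa (D : ReturnData l xs ys A B T) (hX : ∀ᶠ k in atTop, |X k| ≤ R)
    (hw : Tendsto w atTop (𝓝 w₀))
    (hfix : ∀ᶠ k in atTop, scaledFst A B T l ys k (X k) (w k) = X k) :
    Tendsto X atTop (𝓝 xs) := by
  obtain ⟨M, hM, hu⟩ := D.exists_prod_bound_seq hX hw
  have hP := (tendsto_cocycle D.contDiff_fst D.contDiff_snd D.sum_eq_zero D.abs_pos D.abs_lt_one
    hM hu).1
  have h := (((continuous_fst.tendsto _).comp (D.tendsto_fst hX hw)).mul hP)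
  rw [mul_one] at h
  exact h.congr' hfix

theorem tendsto_div_fst (D : ReturnData l xs ys A B T) (hX : Tendsto X atTop (𝓝 xs)) :
    Tendsto (fun k => (l ^ k * X k) / l ^ k) atTop (𝓝 xs) :=
  hX.congr fun k => (mul_div_cancel_left₀ _ (D.pow_ne_zero k)).symm

/-- Along solutions of the first equation the second displacement converges to a quadratic
polynomial in `w`. -/
theorem tendsto_scaledSnd (D : ReturnData l xs ys A B T) {c₁ c₂ d₁ d₂ d₃ d₄ d₅ : ℝ}
    (hT : HasTaylorCoeffs T (0, ys) c₁ c₂ d₁ d₂ d₃ d₄ d₅) (hd₁ : d₁ * xs = ys) (hd₂ : d₂ = 0)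
    (hX : ∀ᶠ k in atTop, |X k| ≤ R) (hw : Tendsto w atTop (𝓝 w₀))
    (hfix : ∀ᶠ k in atTop, scaledFst A B T l ys k (X k) (w k) = X k) :
    Tendsto (fun k => scaledSnd A B T l ys k (X k) (w k)) atTop
      (𝓝 (d₅ * w₀ ^ 2 - (1 - c₂ * d₁ - d₄ * xs) * w₀ + (d₃ * xs ^ 2 + c₁ * d₁ * xs))) := by
  have hXl := D.tendsto_scaled_abscissa hX hw hfix
  obtain ⟨M, hM, hu⟩ := D.exists_prod_bound_seq hX hw
  obtain ⟨hP, hQ, -, -, hPQ⟩ := tendsto_cocycle D.contDiff_fst D.contDiff_snd D.sum_eq_zero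
    D.abs_pos D.abs_lt_one hM hu
  have h1 := D.tendsto_div_fst hXl
  have h2 : Tendsto (fun k => (l ^ k * w k) / l ^ k) atTop (𝓝 w₀) :=
    hw.congr fun k => (mul_div_cancel_left₀ _ (D.pow_ne_zero k)).symm
  have hF := tendsto_taylor_one D.contDiff_T_fst (0, ys) (z := fun k => (l ^ k * X k, l ^ k * w k))
    D.tendsto_pow D.pow_ne_zero h1 h2
  have hG := tendsto_taylor_two D.contDiff_T_snd (0, ys) (z := fun k => (l ^ k * X k, l ^ k * w k))
    D.tendsto_pow D.pow_ne_zero h1 h2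
  have hd₃ : partialX (partialX fun q => (T q).2) (0, ys) = 2 * d₃ := by linarith [hT.d₃_eq]
  have hd₅ : partialY (partialY fun q => (T q).2) (0, ys) = 2 * d₅ := by linarith [hT.d₅_eq]
  rw [← hT.c₁_eq, ← hT.c₂_eq, D.map_eq] at hF
  rw [← hT.d₁_eq, ← hT.d₂_eq, ← hT.d₄_eq, hd₃, hd₅, D.map_eq, hd₂] at hG
  have hPQ1 := hP.mul hQ
  have hlim := (((hPQ.const_mul ys).add ((hF.const_mul d₁).mul hPQ1)).add (hQ.mul hG)).sub hw
  have e : ys * 0 + d₁ * (c₁ * xs + c₂ * w₀) * (1 * 1) +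
      1 * (2 * d₃ / 2 * xs ^ 2 + d₄ * xs * w₀ + 2 * d₅ / 2 * w₀ ^ 2) - w₀ =
      d₅ * w₀ ^ 2 - (1 - c₂ * d₁ - d₄ * xs) * w₀ + (d₃ * xs ^ 2 + c₁ * d₁ * xs) := by ring
  rw [e] at hlim
  refine hlim.congr' ?_
  filter_upwards [hfix] with k hk
  have hl := D.pow_ne_zero k
  rw [scaledSnd]
  rw [scaledFst] at hk
  simp only [sub_zero, zero_mul, add_zero]
  change _ + d₁ * (((T (scaledPoint l ys k (X k) (w k))).1 - xs) / l ^ k) * _ +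
    _ * (((T (scaledPoint l ys k (X k) (w k))).2 - _) / _) - _ = _
  generalize cocycle (productMap A B) A k (scaledProd T l ys k (X k) (w k)) = p at *
  generalize cocycle (productMap A B) B k (scaledProd T l ys k (X k) (w k)) = q at *
  generalize (T (scaledPoint l ys k (X k) (w k))).1 = x at *
  generalize (T (scaledPoint l ys k (X k) (w k))).2 = y at *
  rw [← hk, ← hd₁]
  field_simp
  ring

end Limits

theorem continuousOn_scaledSnd (D : ReturnData l xs ys A B T) {k : ℕ} {ξ : ℝ → ℝ} {S : Set ℝ}
    (hξ : ContinuousOn ξ S) : ContinuousOn (fun w => scaledSnd A B T l ys k (ξ w) w) S := by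
  have hφ := contDiff_productMap D.contDiff_fst D.contDiff_snd
  have hQ := (contDiff_cocycle hφ D.contDiff_snd k).continuous
  have hpt : ContinuousOn (fun w => scaledPoint l ys k (ξ w) w) S := by
    unfold scaledPoint
    fun_prop
  have hTc := D.contDiff_map.continuous.comp_continuousOn hpt
  have h1 := continuous_fst.comp_continuousOn hTc
  have h2 := continuous_snd.comp_continuousOn hTc
  have hu : ContinuousOn (fun w => scaledProd T l ys k (ξ w) w) S := h1.mul h2
  exact ((((h2.mul (hQ.comp_continuousOn hu)).div_const _).sub continuousOn_const).div_const
    _).sub continuousOn_id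

end ReturnData

theorem exists_seq_tendsto_of_forall {P : ℕ → ℝ → Prop} {w₀ : ℝ}
    (h : ∀ r > 0, ∀ᶠ k in atTop, ∃ w, |w - w₀| ≤ r ∧ P k w) :
    ∃ w : ℕ → ℝ, Tendsto w atTop (𝓝 w₀) ∧ ∀ᶠ k in atTop, P k (w k) := by
  have hex : ∀ k, ∃ w, (∃ v, P k v) → P k w ∧
      dist w₀ w < Metric.infDist w₀ {v | P k v} + 1 / (k + 1 : ℝ) := by
    intro k
    by_cases hk : ∃ v, P k v
    · obtain ⟨w, hw, hd⟩ := (Metric.infDist_lt_iff (s := {v | P k v}) hk).1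
        (lt_add_of_pos_right (Metric.infDist w₀ {v | P k v})
          (by positivity : (0 : ℝ) < 1 / (k + 1 : ℝ)))
      exact ⟨w, fun _ => ⟨hw, hd⟩⟩
    · exact ⟨0, fun h => absurd h hk⟩
  choose w hw using hex
  refine ⟨w, ?_, ?_⟩
  · rw [Metric.tendsto_nhds]
    intro ε hε
    filter_upwards [h (ε / 2) (half_pos hε),
      tendsto_one_div_add_atTop_nhds_zero_nat.eventually (gt_mem_nhds (half_pos hε))] with k hk hk'
    obtain ⟨v, hv, hPv⟩ := hk
    have h1 := (hw k ⟨v, hPv⟩).2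
    have h2 : Metric.infDist w₀ {v | P k v} ≤ dist w₀ v := Metric.infDist_le_dist_of_mem hPv
    rw [dist_comm w₀ v, Real.dist_eq] at h2
    rw [dist_comm]
    linarith
  · filter_upwards [h 1 one_pos] with k hk
    obtain ⟨v, -, hv⟩ := hk
    exact (hw k ⟨v, hv⟩).1

theorem quadratic_sign_change {a b c w₀ : ℝ} (h0 : a * w₀ ^ 2 - b * w₀ + c = 0)
    (h1 : 2 * a * w₀ - b ≠ 0) {r : ℝ} (hr : 0 < r) : ∃ ρ, 0 < ρ ∧ ρ ≤ r ∧
      (a * (w₀ - ρ) ^ 2 - b * (w₀ - ρ) + c) * (a * (w₀ + ρ) ^ 2 - b * (w₀ + ρ) + c) < 0 := by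
  set s := 2 * a * w₀ - b with hs
  have hs0 : 0 < |s| := abs_pos.2 h1
  refine ⟨min r (|s| / (2 * (|a| + 1))), by positivity, min_le_left _ _, ?_⟩
  set ρ := min r (|s| / (2 * (|a| + 1))) with hρ
  have hρ0 : 0 < ρ := by positivity
  have h2 : ρ * (2 * (|a| + 1)) ≤ |s| :=
    (le_div_iff₀ (by positivity)).1 (min_le_right _ _)
  have h3 : |a * ρ| < |s| := by
    rw [abs_mul, abs_of_pos hρ0]; nlinarith [abs_nonneg a]
  have h4 := sq_lt_sq.2 h3
  have e : (a * (w₀ - ρ) ^ 2 - b * (w₀ - ρ) + c) * (a * (w₀ + ρ) ^ 2 - b * (w₀ + ρ) + c) =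
      ρ ^ 2 * ((a * ρ) ^ 2 - s ^ 2) := by
    have e1 : a * (w₀ - ρ) ^ 2 - b * (w₀ - ρ) + c = ρ * (a * ρ - s) := by
      rw [hs]; linear_combination h0
    have e2 : a * (w₀ + ρ) ^ 2 - b * (w₀ + ρ) + c = ρ * (a * ρ + s) := by
      rw [hs]; linear_combination h0
    rw [e1, e2]; ring
  rw [e]
  exact mul_neg_of_pos_of_neg (by positivity) (by linarith)

theorem exists_zero_of_mul_neg {g : ℝ → ℝ} {a b : ℝ} (hab : a ≤ b)
    (hg : ContinuousOn g (Set.Icc a b)) (h : g a * g b < 0) : ∃ c ∈ Set.Icc a b, g c = 0 := by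
  have h0 : (0 : ℝ) ∈ Set.uIcc (g a) (g b) := by
    rw [Set.mem_uIcc]
    rcases mul_neg_iff.1 h with h | h
    · exact Or.inr ⟨h.2.le, h.1.le⟩
    · exact Or.inl ⟨h.1.le, h.2.le⟩
  have := intermediate_value_uIcc (f := g) (a := a) (b := b) (by rwa [Set.uIcc_of_le hab])
  rw [Set.uIcc_of_le hab] at this
  exact this h0

/-- Every simple root of the limiting quadratic polynomial is the limit of solutions of the scaled
fixed point equations. -/
theorem ReturnData.exists_solutions {l xs ys : ℝ} {A B : ℝ → ℝ} {T : ℝ × ℝ → ℝ × ℝ}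
    (D : ReturnData l xs ys A B T) {c₁ c₂ d₁ d₂ d₃ d₄ d₅ : ℝ}
    (hT : HasTaylorCoeffs T (0, ys) c₁ c₂ d₁ d₂ d₃ d₄ d₅) (hd₁ : d₁ * xs = ys) (hd₂ : d₂ = 0)
    {w₀ : ℝ}
    (hroot : d₅ * w₀ ^ 2 - (1 - c₂ * d₁ - d₄ * xs) * w₀ + (d₃ * xs ^ 2 + c₁ * d₁ * xs) = 0)
    (hsimple : 2 * d₅ * w₀ - (1 - c₂ * d₁ - d₄ * xs) ≠ 0) :
    ∃ X w : ℕ → ℝ, Tendsto w atTop (𝓝 w₀) ∧ Tendsto X atTop (𝓝 xs) ∧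
      ∀ᶠ k in atTop, scaledFst A B T l ys k (X k) (w k) = X k ∧
        scaledSnd A B T l ys k (X k) (w k) = 0 := by
  set W := |w₀| + 1 with hW
  obtain ⟨R, ξ, hξ⟩ := D.exists_scaledFst_curve W
  have hlim : ∀ v, |v| ≤ W → Tendsto (fun k => scaledSnd A B T l ys k (ξ k v) v) atTop
      (𝓝 (d₅ * v ^ 2 - (1 - c₂ * d₁ - d₄ * xs) * v + (d₃ * xs ^ 2 + c₁ * d₁ * xs))) := fun v hv =>
    D.tendsto_scaledSnd hT hd₁ hd₂ (hξ.mono fun k hk => (hk.2 v hv).1) tendsto_const_nhds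
      (hξ.mono fun k hk => (hk.2 v hv).2)
  obtain ⟨w, hw, hwz⟩ := exists_seq_tendsto_of_forall (w₀ := w₀)
    (P := fun k v => |v| ≤ W ∧ scaledSnd A B T l ys k (ξ k v) v = 0) fun r hr => by
      obtain ⟨ρ, hρ, hρr, hneg⟩ := quadratic_sign_change hroot hsimple (lt_min hr one_pos)
      have hρ1 := hρr.trans (min_le_right _ _)
      have hin : ∀ v ∈ Set.Icc (w₀ - ρ) (w₀ + ρ), |v| ≤ W ∧ |v - w₀| ≤ ρ := fun v hv => by
        have h1 : |v - w₀| ≤ ρ := abs_le.2 ⟨by linarith [hv.1], by linarith [hv.2]⟩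
        have := abs_sub_abs_le_abs_sub v w₀
        exact ⟨by linarith, h1⟩
      have ha := hlim _ (hin (w₀ - ρ) ⟨le_rfl, by linarith⟩).1
      have hb := hlim _ (hin (w₀ + ρ) ⟨by linarith, le_rfl⟩).1
      filter_upwards [hξ, (ha.mul hb).eventually (gt_mem_nhds hneg)] with k hk hk'
      have hsub : Set.Icc (w₀ - ρ) (w₀ + ρ) ⊆ Set.Icc (-W) W := fun v hv =>
        abs_le.1 (hin v hv).1
      obtain ⟨v, hv, hz⟩ := exists_zero_of_mul_neg (by linarith)
        (D.continuousOn_scaledSnd (k := k) (hk.1.mono hsub)) hk'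
      exact ⟨v, (hin v hv).2.trans (hρr.trans (min_le_left _ _)), (hin v hv).1, hz⟩
  have hfix : ∀ᶠ k in atTop, |ξ k (w k)| ≤ R ∧
      scaledFst A B T l ys k (ξ k (w k)) (w k) = ξ k (w k) := by
    filter_upwards [hξ, hwz] with k h1 h2
    exact h1.2 _ h2.1
  refine ⟨fun k => ξ k (w k), w, hw, D.tendsto_scaled_abscissa (hfix.mono fun k h => h.1) hw
    (hfix.mono fun k h => h.2), ?_⟩
  filter_upwards [hfix, hwz] with k h1 h2
  exact ⟨h1.2, h2.2⟩

/-! ### Single-round periodic points: itinerary and multipliers -/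

theorem fderiv_apply_fst_snd {T : ℝ × ℝ → ℝ × ℝ} (hT : ContDiff ℝ ∞ T) (z : ℝ × ℝ) :
    (∀ v, (fderiv ℝ T z v).1 = fderiv ℝ (fun q => (T q).1) z v) ∧
      ∀ v, (fderiv ℝ T z v).2 = fderiv ℝ (fun q => (T q).2) z v := by
  have h : DifferentiableAt ℝ T z := (hT.differentiable (by simp)).differentiableAt
  exact ⟨fun v => by rw [h.hasFDerivAt.fst.fderiv]; rfl, fun v => by
    rw [h.hasFDerivAt.snd.fderiv]; rfl⟩

namespace ReturnData

variable {l xs ys : ℝ} {A B : ℝ → ℝ} {T : ℝ × ℝ → ℝ × ℝ} {X w : ℕ → ℝ} {w₀ : ℝ}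

theorem iterate_normalForm_eq_scaledPoint (D : ReturnData l xs ys A B T) {k : ℕ} {x v : ℝ}
    (h1 : scaledFst A B T l ys k x v = x) (h2 : scaledSnd A B T l ys k x v = 0) :
    (resonantNormalForm l A B)^[k] (T (scaledPoint l ys k x v)) = scaledPoint l ys k x v := by
  have hl := D.pow_ne_zero k
  rw [iterate_resonantNormalForm]
  rw [scaledFst] at h1
  rw [scaledSnd, sub_eq_zero, div_eq_iff hl, sub_eq_iff_eq_add] at h2
  unfold scaledProd at h1 h2
  ext
  · rw [mul_assoc, h1]; simp [scaledPoint]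
  · change (1 / l) ^ k * _ * _ = ys + l ^ k * v
    rw [one_div, inv_pow]
    linear_combination h2

theorem bounded_abscissa (hX : Tendsto X atTop (𝓝 xs)) : ∀ᶠ k in atTop, |X k| ≤ |xs| + 1 :=
  hX.abs.eventually (ge_mem_nhds (lt_add_one _))

theorem eventually_mem_itinerary (D : ReturnData l xs ys A B T) {N : Set (ℝ × ℝ)}
    {δ : ℝ} (hδ : 0 < δ) {k₀ : ℕ}
    (hN : ∀ k ≥ k₀, ∀ j < k, ∀ a b : ℝ, |a - xs| < δ → |b - ys| < δ →
      (l ^ j * a, l ^ (k - j) * b) ∈ N)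
    (hX : Tendsto X atTop (𝓝 xs)) (hw : Tendsto w atTop (𝓝 w₀))
    (hfix : ∀ᶠ k in atTop, scaledFst A B T l ys k (X k) (w k) = X k ∧
        scaledSnd A B T l ys k (X k) (w k) = 0) :
    ∀ᶠ k in atTop, ∀ j < k,
      (resonantNormalForm l A B)^[j] (T (scaledPoint l ys k (X k) (w k))) ∈ N := by
  have hXb := bounded_abscissa hX
  obtain ⟨M, hM, hu⟩ := D.exists_prod_bound_seq hXb hw
  obtain ⟨C, hC, hcoc⟩ := exists_cocycle_estimates D.contDiff_fst D.contDiff_snd D.sum_eq_zero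
    D.abs_lt_one hM
  have hT := D.tendsto_fst hXb hw
  have t0 : Tendsto (fun k : ℕ => C * (k * |l| ^ k)) atTop (𝓝 0) := by
    simpa using (tendsto_self_mul_const_pow_of_abs_lt_one (r := |l|)
      (by simpa using D.abs_lt_one)).const_mul C
  have t1 : Tendsto (fun k => |(T (scaledPoint l ys k (X k) (w k))).1| * (C * (k * |l| ^ k)) +
      |(T (scaledPoint l ys k (X k) (w k))).1 - xs|) atTop (𝓝 0) := by
    have h := (continuous_fst.tendsto _).comp hT
    simpa using (h.abs.mul t0).add ((h.sub_const xs).abs)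
  have t2 : Tendsto (fun k => |(scaledPoint l ys k (X k) (w k)).2| * (4 * (C * (k * |l| ^ k))) +
      |(scaledPoint l ys k (X k) (w k)).2 - ys|) atTop (𝓝 0) := by
    have h := (continuous_snd.tendsto _).comp (D.tendsto_scaledPoint hXb hw)
    simpa using (h.abs.mul (t0.const_mul 4)).add ((h.sub_const ys).abs)
  filter_upwards [hu, hcoc, hfix, eventually_ge_atTop k₀, t0.eventually (ge_mem_nhds one_half_pos),
    t1.eventually (gt_mem_nhds hδ), t2.eventually (gt_mem_nhds hδ)]
    with k hku hkc hkf hk0 hk1 hk2 hk3 j hj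
  have heq := congrArg Prod.snd (D.iterate_normalForm_eq_scaledPoint hkf.1 hkf.2)
  rw [iterate_resonantNormalForm] at heq ⊢
  obtain ⟨-, hPj, hQj, -⟩ := hkc _ hku j hj.le
  obtain ⟨-, -, hQk, -⟩ := hkc _ hku k le_rfl
  unfold scaledProd at hPj hQj hQk
  set σ := C * (k * |l| ^ k) with hσ
  set p := T (scaledPoint l ys k (X k) (w k))
  set P := cocycle (productMap A B) A j (p.1 * p.2)
  set Q := cocycle (productMap A B) B j (p.1 * p.2)
  set Q' := cocycle (productMap A B) B k (p.1 * p.2)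
  set Y := (scaledPoint l ys k (X k) (w k)).2
  have hσ0 : 0 ≤ σ := (abs_nonneg _).trans hPj
  have hQ'2 : 1 / 2 ≤ Q' := by linarith [(abs_le.1 hQk).1]
  have hQ'0 : Q' ≠ 0 := by linarith
  have hb : (1 / l) ^ j * p.2 * Q = l ^ (k - j) * (Y * (Q / Q')) := by
    have hl := D.ne_zero
    rw [← heq]
    simp only
    have e : l ^ k = l ^ (k - j) * l ^ j := by rw [← pow_add, Nat.sub_add_cancel hj.le]
    rw [one_div, inv_pow, inv_pow, e]
    field_simp
  rw [hb, mul_assoc]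
  refine hN k hk0 j hj _ _ ?_ ?_
  · refine lt_of_le_of_lt ?_ hk2
    calc |p.1 * P - xs| = |p.1 * (P - 1) + (p.1 - xs)| := by ring_nf
      _ ≤ |p.1 * (P - 1)| + |p.1 - xs| := abs_add_le _ _
      _ ≤ |p.1| * σ + |p.1 - xs| := by rw [abs_mul]; gcongr
  · refine lt_of_le_of_lt ?_ hk3
    have hr : |Q / Q' - 1| ≤ 4 * σ := by
      rw [div_sub_one hQ'0, abs_div, abs_of_pos (by linarith : 0 < Q'), div_le_iff₀ (by linarith)]
      have : |Q - Q'| ≤ 2 * σ := by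
        calc |Q - Q'| = |(Q - 1) - (Q' - 1)| := by ring_nf
          _ ≤ |Q - 1| + |Q' - 1| := abs_sub _ _
          _ ≤ 2 * σ := by linarith
      nlinarith
    calc |Y * (Q / Q') - ys| = |Y * (Q / Q' - 1) + (Y - ys)| := by ring_nf
      _ ≤ |Y * (Q / Q' - 1)| + |Y - ys| := abs_add_le _ _
      _ ≤ |Y| * (4 * σ) + |Y - ys| := by rw [abs_mul]; gcongr

theorem eventually_ne_and_prod_small (D : ReturnData l xs ys A B T) (hxs : xs ≠ 0)
    (hX : Tendsto X atTop (𝓝 xs)) (hw : Tendsto w atTop (𝓝 w₀)) {η : ℝ} (hη : 0 < η) :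
    ∀ᶠ k in atTop, ∀ j ≤ k,
      (0 < j → (resonantNormalForm l A B)^[j] (T (scaledPoint l ys k (X k) (w k))) ≠
        T (scaledPoint l ys k (X k) (w k))) ∧
      |((resonantNormalForm l A B)^[j] (T (scaledPoint l ys k (X k) (w k)))).1 *
        ((resonantNormalForm l A B)^[j] (T (scaledPoint l ys k (X k) (w k)))).2| < η := by
  have hXb := bounded_abscissa hX
  obtain ⟨M, hM, hu⟩ := D.exists_prod_bound_seq hXb hw
  obtain ⟨C, hC, hcoc⟩ := exists_cocycle_estimates D.contDiff_fst D.contDiff_snd D.sum_eq_zero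
    D.abs_lt_one hM
  have hT := (continuous_fst.tendsto _).comp (D.tendsto_fst hXb hw)
  have t0 : Tendsto (fun k : ℕ => C * (k * |l| ^ k)) atTop (𝓝 0) := by
    simpa using (tendsto_self_mul_const_pow_of_abs_lt_one (r := |l|)
      (by simpa using D.abs_lt_one)).const_mul C
  have t1 : Tendsto (fun k : ℕ => |l| * (1 + C * (k * |l| ^ k))) atTop (𝓝 (|l|)) := by
    simpa using (t0.const_add 1).const_mul |l|
  have t2 : Tendsto (fun k : ℕ => C * |l| ^ k) atTop (𝓝 0) := by
    simpa using D.tendsto_abs_pow.const_mul C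
  filter_upwards [hu, hcoc, t1.eventually (gt_mem_nhds D.abs_lt_one),
    t2.eventually (gt_mem_nhds hη), hT.eventually_ne hxs] with k hku hkc hk1 hk2 hk3 j hj
  obtain ⟨hU, hP, -⟩ := hkc _ hku j hj
  have hl := D.ne_zero
  rw [iterate_resonantNormalForm]
  unfold scaledProd at hU hP
  simp only [Function.comp_apply] at hk3
  set p := T (scaledPoint l ys k (X k) (w k))
  refine ⟨fun hj0 h => ?_, ?_⟩
  · have h1 := congrArg (fun q : ℝ × ℝ => |q.1|) h
    simp only [abs_mul, abs_pow] at h1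
    set P := cocycle (productMap A B) A j (p.1 * p.2)
    have h2 : |P| ≤ 1 + C * (k * |l| ^ k) := by
      have := abs_sub_abs_le_abs_sub P 1
      rw [abs_one] at this
      linarith
    have h3 : |l| ^ j ≤ |l| := by
      simpa using pow_le_pow_of_le_one (abs_nonneg l) D.abs_lt_one.le (show 1 ≤ j from hj0)
    have h4 : |l| ^ j * |P| < 1 :=
      (mul_le_mul h3 h2 (abs_nonneg _) (abs_nonneg _)).trans_lt hk1
    have h5 := mul_lt_mul_of_pos_left h4 (_root_.abs_pos.2 hk3)
    linarith
  · refine lt_of_le_of_lt (le_of_eq_of_le ?_ hU) hk2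
    rw [iterate_productMap]
    have e : l ^ j * (1 / l) ^ j = 1 := by
      rw [← mul_pow, mul_one_div_cancel hl, one_pow]
    congr 1
    linear_combination (p.1 * p.2 * (cocycle (productMap A B) A j (p.1 * p.2) *
        cocycle (productMap A B) B j (p.1 * p.2))) * e

theorem tendsto_trace_det (D : ReturnData l xs ys A B T) {c₁ c₂ d₁ d₂ d₃ d₄ d₅ : ℝ}
    (hT : HasTaylorCoeffs T (0, ys) c₁ c₂ d₁ d₂ d₃ d₄ d₅) (hd₂ : d₂ = 0)
    (hX : Tendsto X atTop (𝓝 xs)) (hw : Tendsto w atTop (𝓝 w₀))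
    (hfix : ∀ᶠ k in atTop, scaledFst A B T l ys k (X k) (w k) = X k ∧
        scaledSnd A B T l ys k (X k) (w k) = 0) {L : ℕ → ℝ × ℝ →L[ℝ] ℝ × ℝ}
    (hL : ∀ᶠ k in atTop, L k = (fderiv ℝ T (scaledPoint l ys k (X k) (w k))).comp
      (fderiv ℝ (resonantNormalForm l A B)^[k] (T (scaledPoint l ys k (X k) (w k))))) :
    Tendsto (fun k => planarTrace (L k)) atTop (𝓝 (d₄ * xs + 2 * d₅ * w₀)) ∧
      Tendsto (fun k => planarDet (L k)) atTop (𝓝 (-(c₂ * d₁))) := by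
  have hXb := bounded_abscissa hX
  obtain ⟨M, hM, hu⟩ := D.exists_prod_bound_seq hXb hw
  obtain ⟨hP, hQ, hP', hQ', -⟩ := tendsto_cocycle D.contDiff_fst D.contDiff_snd D.sum_eq_zero
    D.abs_pos D.abs_lt_one hM hu
  have hz := D.tendsto_scaledPoint hXb hw
  have hp := D.tendsto_fst hXb hw
  have hx := (continuous_fst.tendsto _).comp hp
  have he := D.tendsto_pow
  have hYz := (continuous_snd.tendsto _).comp hz
  set z : ℕ → ℝ × ℝ := fun k => scaledPoint l ys k (X k) (w k) with hzdef
  set P : ℕ → ℝ := fun k => cocycle (productMap A B) A k (scaledProd T l ys k (X k) (w k))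
  set Q : ℕ → ℝ := fun k => cocycle (productMap A B) B k (scaledProd T l ys k (X k) (w k))
  set P' : ℕ → ℝ := fun k => deriv (cocycle (productMap A B) A k)
    (scaledProd T l ys k (X k) (w k))
  set Q' : ℕ → ℝ := fun k => deriv (cocycle (productMap A B) B k)
    (scaledProd T l ys k (X k) (w k))
  change Tendsto (fun k => (T (z k)).1) atTop (𝓝 xs) at hx
  change Tendsto (fun k => l ^ k * P' k) atTop (𝓝 0) at hP'
  change Tendsto (fun k => l ^ k * Q' k) atTop (𝓝 0) at hQ'
  have hy : Tendsto (fun k => (T (z k)).2 / l ^ k) atTop (𝓝 ys) := by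
    have h := hYz.div hQ one_ne_zero
    rw [div_one] at h
    refine h.congr' ?_
    filter_upwards [hfix, hQ.eventually_ne one_ne_zero] with k hk hk0
    have h1 := congrArg Prod.snd (D.iterate_normalForm_eq_scaledPoint hk.1 hk.2)
    rw [iterate_resonantNormalForm] at h1
    simp only [Pi.div_apply, Function.comp_apply, hzdef]
    rw [← h1, one_div, inv_pow]
    change (_ * Q k) / Q k = _
    field_simp
  have huP : Tendsto (fun k => (T (z k)).1 * ((T (z k)).2 / l ^ k) * (l ^ k * P' k))
    atTop (𝓝 0) := by simpa using (hx.mul hy).mul hP'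
  have huQ : Tendsto (fun k => (T (z k)).1 * ((T (z k)).2 / l ^ k) * (l ^ k * Q' k))
    atTop (𝓝 0) := by simpa using (hx.mul hy).mul hQ'
  have hFx := ((contDiff_partialX D.contDiff_T_fst).continuous.tendsto _).comp hz
  have hFy := ((contDiff_partialY D.contDiff_T_fst).continuous.tendsto _).comp hz
  have hGx := ((contDiff_partialX D.contDiff_T_snd).continuous.tendsto _).comp hz
  have hGy := ((contDiff_partialY D.contDiff_T_snd).continuous.tendsto _).comp hz
  have hGy' := tendsto_taylor_one (contDiff_partialY D.contDiff_T_snd) (0, ys)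
    (z := fun k => (l ^ k * X k, l ^ k * w k)) D.tendsto_pow D.pow_ne_zero (D.tendsto_div_fst hX)
    (hw.congr fun k => (mul_div_cancel_left₀ _ (D.pow_ne_zero k)).symm)
  have hd₅ : partialY (partialY fun q => (T q).2) (0, ys) = 2 * d₅ := by linarith [hT.d₅_eq]
  rw [← hT.d₂_eq, ← hT.d₄_eq, hd₅, hd₂] at hGy'
  rw [← hT.c₁_eq] at hFx
  rw [← hT.c₂_eq] at hFy
  rw [← hT.d₁_eq] at hGx
  rw [← hT.d₂_eq, hd₂] at hGy
  have hD : ∀ k, (fderiv ℝ (resonantNormalForm l A B)^[k] (T (z k)) (1, 0) =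
      (l ^ k * (P k + (T (z k)).1 * (T (z k)).2 * P' k), (1 / l) ^ k * (T (z k)).2 ^ 2 * Q' k)) ∧
      (fderiv ℝ (resonantNormalForm l A B)^[k] (T (z k)) (0, 1) =
      (l ^ k * (T (z k)).1 ^ 2 * P' k, (1 / l) ^ k * (Q k + (T (z k)).1 * (T (z k)).2 * Q' k))) := by
    intro k
    have hφ := contDiff_productMap D.contDiff_fst D.contDiff_snd
    obtain ⟨D₀, hD₀, h1, h2⟩ := hasFDerivAt_cross (contDiff_cocycle hφ D.contDiff_fst k)
      (contDiff_cocycle hφ D.contDiff_snd k) (l ^ k) ((1 / l) ^ k) (T (z k))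
    rw [show (resonantNormalForm l A B)^[k] = _ from funext (iterate_resonantNormalForm l A B k),
      hD₀.fderiv]
    exact ⟨h1, h2⟩
  constructor
  · have hlim := (((hFx.mul ((he.mul hP).add (he.mul huP))).add (hFy.mul ((hy.pow 2).mul hQ'))).add
      (hGx.mul ((hx.pow 2).mul hP'))).add (hGy'.mul (hQ.add huQ))
    have e : c₁ * (0 * 1 + 0 * 0) + c₂ * (ys ^ 2 * 0) + d₁ * (xs ^ 2 * 0) +
        (d₄ * xs + 2 * d₅ * w₀) * (1 + 0) = d₄ * xs + 2 * d₅ * w₀ := by ring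
    rw [e] at hlim
    refine hlim.congr' ?_
    filter_upwards [hL] with k hk
    obtain ⟨h1, h2⟩ := fderiv_apply_fst_snd D.contDiff_map (z k)
    have hl := D.pow_ne_zero k
    rw [hk, planarTrace_comp, (hD k).1, (hD k).2]
    change _ = (fderiv ℝ T (z k) (1, 0)).1 * _ + (fderiv ℝ T (z k) (0, 1)).1 * _ +
      (fderiv ℝ T (z k) (1, 0)).2 * _ + (fderiv ℝ T (z k) (0, 1)).2 * _
    rw [h1, h1, h2, h2, one_div, inv_pow]
    simp only [sub_zero, Function.comp_apply]
    change partialX _ _ * _ + partialY _ _ * _ + partialX _ _ * _ + partialY _ (z k) / _ * _ =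
      partialX _ _ * _ + partialY _ _ * _ + partialX _ _ * _ + partialY _ _ * _
    field_simp
  · have hlim := (((hFx.mul hGy).sub (hFy.mul hGx))).mul
      (((hP.add huP).mul (hQ.add huQ)).sub (huP.mul huQ))
    have e : (c₁ * 0 - c₂ * d₁) * ((1 + 0) * (1 + 0) - 0 * 0) = -(c₂ * d₁) := by ring
    rw [e] at hlim
    refine hlim.congr' ?_
    filter_upwards [hL] with k hk
    obtain ⟨h1, h2⟩ := fderiv_apply_fst_snd D.contDiff_map (z k)
    have hl := D.pow_ne_zero k
    rw [hk, planarDet_comp, planarDet, planarDet, (hD k).1, (hD k).2]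
    change _ = ((fderiv ℝ T (z k) (1, 0)).1 * (fderiv ℝ T (z k) (0, 1)).2 -
      (fderiv ℝ T (z k) (0, 1)).1 * (fderiv ℝ T (z k) (1, 0)).2) * _
    rw [h1, h1, h2, h2, one_div, inv_pow]
    simp only [Function.comp_apply]
    change (partialX _ _ * partialY _ _ - partialY _ _ * partialX _ _) * _ =
      (partialX _ _ * partialY _ _ - partialY _ _ * partialX _ _) * _
    congr 1
    field_simp

end ReturnData

/-- Every simple root of the limiting quadratic polynomial gives rise to a family of single-round
periodic solutions whose multipliers converge. -/
theorem exists_family {f : ℝ × ℝ → ℝ × ℝ} (hf : ContDiff ℝ ∞ f) {l xs ys : ℝ} {A B : ℝ → ℝ}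
    {m : ℕ} (D : ReturnData l xs ys A B f^[m]) {N : Set (ℝ × ℝ)} (hNopen : IsOpen N)
    (hNconv : Convex ℝ N) (hN0 : (0, 0) ∈ N) (hN1 : (xs, 0) ∈ N) (hN2 : (l * xs, 0) ∈ N)
    (hN3 : (0, l * ys) ∈ N) (hN4 : (0, l * (l * ys)) ∈ N)
    (hfN : ∀ p ∈ N, f p = resonantNormalForm l A B p) (hxs : xs ≠ 0)
    {c₁ c₂ d₁ d₂ d₃ d₄ d₅ : ℝ} (hT : HasTaylorCoeffs f^[m] (0, ys) c₁ c₂ d₁ d₂ d₃ d₄ d₅)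
    (hd₁ : d₁ * xs = ys) (hd₂ : d₂ = 0) {w₀ : ℝ}
    (hroot : d₅ * w₀ ^ 2 - (1 - c₂ * d₁ - d₄ * xs) * w₀ + (d₃ * xs ^ 2 + c₁ * d₁ * xs) = 0)
    (hsimple : 2 * d₅ * w₀ - (1 - c₂ * d₁ - d₄ * xs) ≠ 0) :
    ∃ p : ℕ → ℝ × ℝ, Tendsto p atTop (𝓝 (xs, 0)) ∧
      (∀ η > 0, ∀ᶠ k in atTop, IsSRSolution f N η m k (p k)) ∧
      (∀ᶠ k in atTop, f^[k + m] (p k) = p k) ∧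
      Tendsto (fun k => planarTrace (fderiv ℝ f^[k + m] (p k))) atTop
        (𝓝 (d₄ * xs + 2 * d₅ * w₀)) ∧
      Tendsto (fun k => planarDet (fderiv ℝ f^[k + m] (p k))) atTop (𝓝 (-(c₂ * d₁))) := by
  obtain ⟨X, w, hw, hX, hfix⟩ := D.exists_solutions hT hd₁ hd₂ hroot hsimple
  obtain ⟨δ, hδ, k₀, hN⟩ := exists_axes_nhd D.abs_lt_one hNopen hNconv hN0 hN1 hN2 hN3 hN4
  have hmem := D.eventually_mem_itinerary hδ hN hX hw hfix
  have hT0 := contDiff_resonantNormalForm l D.contDiff_fst D.contDiff_snd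
  have hev : ∀ᶠ k in atTop, ∀ j ≤ k, f^[j] =ᶠ[𝓝 (f^[m] (scaledPoint l ys k (X k) (w k)))]
      (resonantNormalForm l A B)^[j] := by
    filter_upwards [hmem] with k hk j hj
    exact iterate_eventuallyEq hNopen hT0.continuous hfN fun i hi => hk i (by omega)
  have hper : ∀ᶠ k in atTop, f^[k] (f^[m] (scaledPoint l ys k (X k) (w k))) =
      scaledPoint l ys k (X k) (w k) := by
    filter_upwards [hev, hfix] with k hk hkf
    rw [(hk k le_rfl).eq_of_nhds, D.iterate_normalForm_eq_scaledPoint hkf.1 hkf.2]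
  have hper' : ∀ᶠ k in atTop, f^[k + m] (f^[m] (scaledPoint l ys k (X k) (w k))) =
      f^[m] (scaledPoint l ys k (X k) (w k)) := by
    filter_upwards [hper] with k hk
    rw [add_comm, Function.iterate_add_apply, hk]
  have hL : ∀ᶠ k in atTop, fderiv ℝ f^[k + m] (f^[m] (scaledPoint l ys k (X k) (w k))) =
      (fderiv ℝ f^[m] (scaledPoint l ys k (X k) (w k))).comp
      (fderiv ℝ (resonantNormalForm l A B)^[k] (f^[m] (scaledPoint l ys k (X k) (w k)))) := by
    filter_upwards [hev, hper] with k hk hkp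
    rw [add_comm, Function.iterate_add, fderiv_comp _
      ((contDiff_iterate hf m).differentiable (by simp)).differentiableAt
      ((contDiff_iterate hf k).differentiable (by simp)).differentiableAt, hkp,
      (hk k le_rfl).fderiv_eq]
  refine ⟨fun k => f^[m] (scaledPoint l ys k (X k) (w k)),
    D.tendsto_fst (ReturnData.bounded_abscissa hX) hw, fun η hη => ?_, hper',
    D.tendsto_trace_det hT hd₂ hX hw hfix hL⟩
  filter_upwards [hmem, hev, hper', D.eventually_ne_and_prod_small hxs hX hw hη,
    eventually_ge_atTop m, eventually_gt_atTop 0] with k h1 h2 h3 h4 h5 h6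
  refine ⟨minimalPeriod_eq_of_ne h6 h5 h3 fun n hn hnk => ?_, fun j hj => ?_⟩
  · rw [(h2 n hnk).eq_of_nhds]
    exact (h4 n hnk).1 hn
  · rw [(h2 j hj.le).eq_of_nhds]
    exact ⟨h1 j hj, (h4 j hj.le).2⟩

end GRHT

theorem mainTheorem2
    (f : ℝ × ℝ → ℝ × ℝ) (hf : ContDiff ℝ ∞ f)
    (l s : ℝ) (hl0 : 0 < |l|) (hl1 : |l| < 1) (hs : 1 < |s|) (hls : l * s = 1)
    (A B : ℝ → ℝ) (hA : ContDiff ℝ ∞ A) (hB : ContDiff ℝ ∞ B)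
    (N : Set (ℝ × ℝ)) (hNopen : IsOpen N) (hN0 : (0, 0) ∈ N) (hNconv : Convex ℝ N)
    (hNbdd : Bornology.IsBounded N)
    (hfN : ∀ p ∈ N, f p = GRHT.resonantNormalForm l A B p)
    (xs ys : ℝ) (hxs : 0 < xs) (hys : 0 < ys)
    (hN1 : (xs, 0) ∈ N) (hN2 : (l * xs, 0) ∈ N)
    (hN3 : (0, ys / s) ∈ N) (hN4 : (0, ys / s ^ 2) ∈ N)
    (m : ℕ) (hm : 1 ≤ m) (hexc : f^[m] (0, ys) = (xs, 0))
    (c₁ c₂ d₁ d₂ d₃ d₄ d₅ : ℝ)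
    (hT : GRHT.HasTaylorCoeffs (f^[m]) (0, ys) c₁ c₂ d₁ d₂ d₃ d₄ d₅)
    (hd₁ : d₁ = ys / xs) (hd₂ : d₂ = 0) (hab : A 0 + B 0 = 0) (hd₅ : d₅ ≠ 0)
    (hdiscr : 0 < GRHT.discr xs ys c₁ c₂ d₁ d₃ d₄ d₅)
    (hstab₁ : -1 < c₂ * ys / xs)
    (hstab₂ : c₂ * ys / xs < 1 - √(GRHT.discr xs ys c₁ c₂ d₁ d₃ d₄ d₅) / 2) :
    ∃ p q : ℕ → ℝ × ℝ,
      Tendsto p atTop (𝓝 (xs, 0)) ∧ Tendsto q atTop (𝓝 (xs, 0)) ∧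
      ∀ η > 0, ∃ kmin : ℕ, ∀ k ≥ kmin,
        (GRHT.IsSRSolution f N η m k (p k) ∧ GRHT.IsAsymptoticallyStable f (p k)) ∧
        (GRHT.IsSRSolution f N η m k (q k) ∧ GRHT.IsSaddle f (k + m) (q k)) := by
  have hs0 : s ≠ 0 := by rintro rfl; simp at hls
  have hls' : l = 1 / s := by rw [eq_div_iff hs0]; exact hls
  have e3 : ys / s = l * ys := by rw [hls']; ring
  have e4 : ys / s ^ 2 = l * (l * ys) := by rw [hls']; field_simp
  rw [e3] at hN3
  rw [e4] at hN4
  have hd₁' : d₁ * xs = ys := by rw [hd₁]; field_simp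
  have hcd : c₂ * ys / xs = c₂ * d₁ := by rw [hd₁]; ring
  have hdd : d₄ * ys / d₁ = d₄ * xs := by
    rw [hd₁]; field_simp
  have hdis : GRHT.discr xs ys c₁ c₂ d₁ d₃ d₄ d₅ =
      (1 - c₂ * d₁ - d₄ * xs) ^ 2 - 4 * d₅ * (d₃ * xs ^ 2 + c₁ * d₁ * xs) := by
    rw [GRHT.discr, hcd, hdd]
  set Δ := GRHT.discr xs ys c₁ c₂ d₁ d₃ d₄ d₅
  rw [hcd] at hstab₁ hstab₂
  have hr0 : 0 < √Δ := Real.sqrt_pos.2 hdiscr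
  have hrr : √Δ ^ 2 = Δ := Real.sq_sqrt hdiscr.le
  set r := √Δ
  have D : GRHT.ReturnData l xs ys A B f^[m] :=
    ⟨hl0, hl1, hA, hB, hab, GRHT.contDiff_iterate hf m, hexc⟩
  have hfam : ∀ ρ : ℝ, ρ ^ 2 = Δ → ρ ≠ 0 → ∃ p : ℕ → ℝ × ℝ, Tendsto p atTop (𝓝 (xs, 0)) ∧
      (∀ η > 0, ∀ᶠ k in atTop, GRHT.IsSRSolution f N η m k (p k)) ∧
      (∀ᶠ k in atTop, f^[k + m] (p k) = p k) ∧
      Tendsto (fun k => GRHT.planarTrace (fderiv ℝ f^[k + m] (p k))) atTop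
        (𝓝 (1 - c₂ * d₁ + ρ)) ∧
      Tendsto (fun k => GRHT.planarDet (fderiv ℝ f^[k + m] (p k))) atTop (𝓝 (-(c₂ * d₁))) := by
    intro ρ hρ hρ0
    have hw : 2 * d₅ * ((1 - c₂ * d₁ - d₄ * xs + ρ) / (2 * d₅)) = 1 - c₂ * d₁ - d₄ * xs + ρ :=
      mul_div_cancel₀ _ (by simpa using hd₅)
    have hroot : d₅ * ((1 - c₂ * d₁ - d₄ * xs + ρ) / (2 * d₅)) ^ 2 -
        (1 - c₂ * d₁ - d₄ * xs) * ((1 - c₂ * d₁ - d₄ * xs + ρ) / (2 * d₅)) +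
        (d₃ * xs ^ 2 + c₁ * d₁ * xs) = 0 := by
      have : ρ ^ 2 = (1 - c₂ * d₁ - d₄ * xs) ^ 2 - 4 * d₅ * (d₃ * xs ^ 2 + c₁ * d₁ * xs) :=
        hρ.trans hdis
      field_simp
      linear_combination this
    have h := GRHT.exists_family hf D hNopen hNconv hN0 hN1 hN2 hN3 hN4 hfN hxs.ne' hT hd₁' hd₂
      hroot (by rw [hw]; simpa using hρ0)
    rwa [hw, show d₄ * xs + (1 - c₂ * d₁ - d₄ * xs + ρ) = 1 - c₂ * d₁ + ρ by ring] at h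
  obtain ⟨p, hp, hpS, hpP, hpt, hpd⟩ := hfam (-r) (by rw [neg_sq, hrr]) (by simpa using hr0.ne')
  obtain ⟨q, hq, hqS, hqP, hqt, hqd⟩ := hfam r hrr hr0.ne'
  have hpStab : ∀ᶠ k in atTop, GRHT.IsAsymptoticallyStable f (p k) := by
    have h1 := hpt.abs.eventually_lt (hpd.const_add 1) (abs_lt.2 ⟨by linarith, by linarith⟩)
    filter_upwards [h1, hpd.eventually (gt_mem_nhds (by linarith : -(c₂ * d₁) < 1)), hpP]
      with k hk1 hk2 hk3
    exact GRHT.isAsymptoticallyStable_of_trace_det hf (by omega) hk3 hk1 hk2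
  have hqSad : ∀ᶠ k in atTop, GRHT.IsSaddle f (k + m) (q k) := by
    filter_upwards [(hqd.const_add 1).eventually_lt hqt (by linarith),
      (hqd.const_add 1).neg.eventually_lt hqt (by linarith)] with k hk1 hk2
    exact GRHT.isSaddle_of_trace_det hk1 hk2
  refine ⟨p, q, hp, hq, fun η hη => ?_⟩
  exact eventually_atTop.1 (((hpS η hη).and hpStab).and ((hqS η hη).and hqSad))
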